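/- **Setting.** For $x\in\mathbb R^d$ let $x^{(2)}\in\mathbb R^{\binom{d+1}{2}}$ be the reduced tensor square, indexed by pairs $1\le k\le l\le d$, with $x^{(2)}_{(k,l)}=\sqrt2\,x_kx_l$ for $k<l$ and $x^{(2)}_{(k,k)}=|x_k|^2$. For a random vector $x$ put $\overline x^{(2)}=x^{(2)}-\mathbb E x^{(2)}$, and let $\mathbb E\big[\overline x^{(2)}\,\overline x^{(2)\top}\big]$ be its covariance matrix. $\|\cdot\|$ denotes the $\ell_2\to\ell_2$ operator norm of a matrix. **Lemma.** (1) For all $M,C_3$ there is a constant $C$, depending only on $M$ and $C_3$, such that the following holds for every $d\ge1$. Let $\Sigma\in\mathbb R^{d\times d}$ be diagonal and positive semidefinite with $\|\Sigma\|\le C_3$, and let $x=\Sigma^{1/2}z$, where $z\in\mathbb R^d$ is a random vector with independent entries satisfying $\mathbb E z_k=\mathbb E z_k^3=\mathbb E z_k^5=0$ and $\mathbb E|z_k|^{56}\le M$ for all $k$. Then, with $\Sigma^{(2)}=\mathbb E[\overline x^{(2)}\overline x^{(2)\top}]$, for every deterministic $A\in\mathbb R^{\binom{d+1}2\times\binom{d+1}2}$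 with $\|A\|\le 1$, the expectation below is finite and $$\mathbb E\left|\overline x^{(2)\top}A\,\overline x^{(2)}-\operatorname{Tr}\big[A\Sigma^{(2)}\big]\right|^{14}\le C\,d^{25.5}.$$ (2) For all $C_1,C_2,C_3$ there is a constant $C$, depending only on $C_1,C_2,C_3$, such that the following holds for all $d\ge 1$ and all $n$ with $d^2\le C_1 n$. Let $\Sigma\in\mathbb R^{d\times d}$ be diagonal and positive semidefinite with $\|\Sigma\|\le C_3$, and let $x_i=\Sigma^{1/2}z_i$, $i\in[n]$, where $z_1,\dots,z_n\in\mathbb R^d$ are independent random vectors (not necessarily identically distributed), each with independent entries, such that for all $i,k$ one has $\mathbb E[z_i(k)^t]=\mathbb E[g^t]$ for $t=1,\dots,8$, where $g\sim\mathcal N(0,1)$, and $\mathbb E[|z_i(k)|^{90}]^{1/90}\le C_2$. Let $\Sigma^{(2)}=\mathbb E[\overline x_{i_0}^{(2)}\overline x_{i_0}^{(2)\top}]$, which does not depend on the choice of $i_0\in[n]$. Then for every deterministic $A\in\mathbb R^{\binom{d+1}2\times\binom{d+1}2}$ with $\|A\|\le1$, with probability at least $1-C\,d^{-1/5}$, $$\frac1n\left|\overline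 x_i^{(2)\top}A\,\overline x_i^{(2)}-\operatorname{Tr}\big[A\Sigma^{(2)}\big]\right|\le C\,n^{-1/60}\qquad\text{simultaneously for all } i\in[n].$$ -/

import Mathlib

open MeasureTheory ProbabilityTheory
open scoped Matrix MatrixOrder Matrix.Norms.L2Operator

noncomputable section

/-- The index set of pairs `(k, l)` with `k ≤ l`, of cardinality `d (d + 1) / 2`. -/
abbrev PairIdx (d : ℕ) : Type := {p : Fin d × Fin d // p.1 ≤ p.2}

/-- The reduced tensor square of a vector `x`: its `(k, l)` entry is `√2 * x k * x l`
for `k < l`, and `|x k| ^ 2` for `k = l`. -/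
def reducedTensor {d : ℕ} (x : Fin d → ℝ) : PairIdx d → ℝ := fun p =>
  if p.1.1 < p.1.2 then √2 * x p.1.1 * x p.1.2 else |x p.1.1| ^ 2

/-- The centered reduced tensor square of a random vector `x`. -/
def centeredTensor {Ω : Type*} [MeasurableSpace Ω] (μ : Measure Ω) {d : ℕ}
    (x : Ω → Fin d → ℝ) (ω : Ω) : PairIdx d → ℝ := fun p =>
  reducedTensor (x ω) p - ∫ ω', reducedTensor (x ω') p ∂μ

/-- The covariance matrix of the reduced tensor square of a random vector `x`. -/
def tensorCov {Ω : Type*} [MeasurableSpace Ω] (μ : Measure Ω) {d : ℕ}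
    (x : Ω → Fin d → ℝ) : Matrix (PairIdx d) (PairIdx d) ℝ :=
  Matrix.of fun p q => ∫ ω, centeredTensor μ x ω p * centeredTensor μ x ω q ∂μ

/-- The deviation of the quadratic form `vᵀ A v` from the trace of `A * S`, in absolute value. -/
def quadDev {ι : Type*} [Fintype ι] (A S : Matrix ι ι ℝ) (v : ι → ℝ) : ℝ :=
  |v ⬝ᵥ (A *ᵥ v) - (A * S).trace|

/-- The random vector `Σ^{1/2} z`, with the positive semidefinite square root of `Σ`
(written `S`). -/
def scaledVec {Ω : Type*} {d : ℕ} (S : Matrix (Fin d) (Fin d) ℝ)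
    (z : Ω → Fin d → ℝ) (ω : Ω) : Fin d → ℝ :=
  CFC.sqrt S *ᵥ z ω

end

section EfronStein

lemma integral_comp_of_measurePreserving {X Y : Type*} [MeasurableSpace X] [MeasurableSpace Y]
    {μ : Measure X} {μ' : Measure Y} {φ : X → Y} (hφ : MeasurePreserving φ μ μ') {g : Y → ℝ}
    (hg : AEStronglyMeasurable g μ') : ∫ p, g (φ p) ∂μ = ∫ y, g y ∂μ' := by
  rw [← hφ.map_eq, integral_map hφ.aemeasurable (by rwa [hφ.map_eq])]

variable {ι E : Type*} [DecidableEq ι]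

/-- Replace the coordinates in `s` of the first copy by those of the second copy. -/
def resample (s : Finset ι) (p : ι → E × E) : ι → E :=
  fun k => if k ∈ s then (p k).2 else (p k).1

/-- Exchange the two copies on the coordinates in `s`. -/
def swapOn (s : Finset ι) (p : ι → E × E) : ι → E × E :=
  fun k => if k ∈ s then (p k).swap else p k

lemma resample_swapOn (s t : Finset ι) (p : ι → E × E) :
    resample s (swapOn t p) = resample (symmDiff s t) p := by
  funext k
  by_cases hs : k ∈ s <;> by_cases ht : k ∈ t <;>
    simp [resample, swapOn, Finset.mem_symmDiff, hs, ht]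

variable [Fintype ι] [MeasurableSpace E]

/-- The law of two independent copies of a random vector with independent coordinates. -/
noncomputable def doubled (ν : ι → Measure E) : Measure (ι → E × E) :=
  Measure.pi fun k => (ν k).prod (ν k)

variable (ν : ι → Measure E) [∀ k, IsProbabilityMeasure (ν k)]

instance : IsProbabilityMeasure (doubled ν) := by unfold doubled; infer_instance

lemma measurePreserving_resample (s : Finset ι) :
    MeasurePreserving (resample s) (doubled ν) (Measure.pi ν) := by
  have := measurePreserving_pi (fun k => (ν k).prod (ν k)) ν
    (f := fun k => if k ∈ s then Prod.snd else Prod.fst) (fun k => by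
      split_ifs
      · exact measurePreserving_snd
      · exact measurePreserving_fst)
  convert! this using 1
  funext p k
  simp only [resample]
  split_ifs <;> rfl

lemma measurePreserving_swapOn (s : Finset ι) :
    MeasurePreserving (swapOn s) (doubled ν) (doubled ν) := by
  have := measurePreserving_pi (fun k => (ν k).prod (ν k)) (fun k => (ν k).prod (ν k))
    (f := fun k => if k ∈ s then Prod.swap else id) (fun k => by
      split_ifs
      · exact Measure.measurePreserving_swap
      · exact MeasurePreserving.id _)
  convert! this using 1
  funext p k
  simp only [swapOn]
  split_ifs <;> rfl

variable {ν}

lemma integral_resample_mul {f : (ι → E) → ℝ} :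
    ∫ p, f (resample ∅ p) * f (resample Finset.univ p) ∂(doubled ν)
      = (∫ x, f x ∂(Measure.pi ν)) ^ 2 := by
  have h := measurePreserving_arrowProdEquivProdArrow E E ι ν ν
  have h2 := h.integral_comp (MeasurableEquiv.measurableEmbedding _)
    (fun q : (ι → E) × (ι → E) => f q.1 * f q.2)
  rw [integral_prod_mul] at h2
  rw [sq, ← h2]
  unfold doubled
  congr 1
  funext p
  have h0 : resample ∅ p = fun k => (p k).1 := by funext k; simp [resample]
  have h1 : resample Finset.univ p = fun k => (p k).2 := by funext k; simp [resample]
  rw [h0, h1]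
  simp [MeasurableEquiv.arrowProdEquivProdArrow, Equiv.arrowProdEquivProdArrow]

lemma efronStein_aux {f : (ι → E) → ℝ} (hf : MemLp f 2 (Measure.pi ν)) (s : Finset ι) :
    ∫ p, f (resample ∅ p) * (f (resample ∅ p) - f (resample s p)) ∂(doubled ν)
      ≤ (1 / 2) * ∑ k ∈ s, ∫ p, (f (resample ∅ p) - f (resample {k} p)) ^ 2 ∂(doubled ν) := by
  have hS (s : Finset ι) : MemLp (fun p => f (resample s p)) 2 (doubled ν) :=
    hf.comp_measurePreserving (measurePreserving_resample ν s)
  have hM (s t u : Finset ι) : Integrable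
      (fun p => f (resample s p) * (f (resample t p) - f (resample u p))) (doubled ν) :=
    (hS s).integrable_mul ((hS t).sub (hS u))
  have hQ (s t : Finset ι) : Integrable
      (fun p => (f (resample s p) - f (resample t p)) ^ 2) (doubled ν) :=
    ((hS s).sub (hS t)).integrable_sq
  induction s using Finset.induction_on with
  | empty => simp
  | insert k s hk ih =>
    rw [Finset.sum_insert hk]
    have e1 : ∫ p, f (resample ∅ p) * (f (resample ∅ p) - f (resample (insert k s) p)) ∂(doubled ν)
        = ∫ p, f (resample ∅ p) * (f (resample ∅ p) - f (resample s p)) ∂(doubled ν)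
        + ∫ p, f (resample ∅ p) * (f (resample s p) - f (resample (insert k s) p)) ∂(doubled ν) := by
      rw [← integral_add (hM _ _ _) (hM _ _ _)]
      congr 1; funext p; ring
    have d1 : symmDiff s {k} = insert k s := by
      ext j; simp only [Finset.mem_symmDiff, Finset.mem_singleton, Finset.mem_insert]; grind
    have d2 : symmDiff (insert k s) {k} = s := by
      ext j; simp only [Finset.mem_symmDiff, Finset.mem_singleton, Finset.mem_insert]; grind
    have d3 : symmDiff {k} s = insert k s := by rw [symmDiff_comm, d1]
    have e2 : ∫ p, f (resample ∅ p) * (f (resample s p) - f (resample (insert k s) p)) ∂(doubled ν)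
        = ∫ p, f (resample {k} p) * (f (resample (insert k s) p) - f (resample s p))
          ∂(doubled ν) := by
      rw [← integral_comp_of_measurePreserving (measurePreserving_swapOn ν {k})
        (hM _ _ _).aestronglyMeasurable]
      simp only [resample_swapOn, d1, d2, ← Finset.bot_eq_empty, bot_symmDiff]
    have e3 : ∫ p, (f (resample s p) - f (resample (insert k s) p)) ^ 2 ∂(doubled ν)
        = ∫ p, (f (resample ∅ p) - f (resample {k} p)) ^ 2 ∂(doubled ν) := by
      rw [← integral_comp_of_measurePreserving (measurePreserving_swapOn ν s)
        (hQ ∅ {k}).aestronglyMeasurable]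
      simp only [resample_swapOn, d3, ← Finset.bot_eq_empty, bot_symmDiff]
    have e4 : 2 * ∫ p, f (resample ∅ p) * (f (resample s p) - f (resample (insert k s) p))
          ∂(doubled ν)
        ≤ (1 / 2) * ∫ p, (f (resample ∅ p) - f (resample {k} p)) ^ 2 ∂(doubled ν)
        + (1 / 2) * ∫ p, (f (resample s p) - f (resample (insert k s) p)) ^ 2 ∂(doubled ν) := by
      rw [two_mul]
      nth_rewrite 2 [e2]
      rw [← integral_add (hM _ _ _) (hM _ _ _), ← integral_const_mul, ← integral_const_mul,
        ← integral_add ((hQ _ _).const_mul _) ((hQ _ _).const_mul _)]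
      refine integral_mono ((hM _ _ _).add (hM _ _ _))
        (((hQ _ _).const_mul _).add ((hQ _ _).const_mul _)) fun p => ?_
      simp only
      nlinarith [sq_nonneg ((f (resample ∅ p) - f (resample {k} p))
        - (f (resample s p) - f (resample (insert k s) p)))]
    rw [e1]
    linarith

/-- The **Efron-Stein inequality**. -/
theorem efronStein {f : (ι → E) → ℝ} (hf : MemLp f 2 (Measure.pi ν)) :
    ∫ x, f x ^ 2 ∂(Measure.pi ν) - (∫ x, f x ∂(Measure.pi ν)) ^ 2
      ≤ (1 / 2) * ∑ k, ∫ p, (f (resample ∅ p) - f (resample {k} p)) ^ 2 ∂(doubled ν) := by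
  have hS (s : Finset ι) : MemLp (fun p => f (resample s p)) 2 (doubled ν) :=
    hf.comp_measurePreserving (measurePreserving_resample ν s)
  refine le_trans (le_of_eq ?_) (efronStein_aux hf Finset.univ)
  rw [← integral_resample_mul, ← integral_comp_of_measurePreserving
    (measurePreserving_resample ν ∅) hf.integrable_sq.aestronglyMeasurable,
    ← integral_sub (hS _).integrable_sq
      (show Integrable (fun p => f (resample ∅ p) * f (resample Finset.univ p)) (doubled ν) from
        (hS _).integrable_mul (hS _))]
  congr 1; funext p; ring

end EfronStein

section MomentInequality

lemma sq_integral_mul_le {X : Type*} [MeasurableSpace X] {μ : Measure X} {f g : X → ℝ}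
    (hf : MemLp f 2 μ) (hg : MemLp g 2 μ) :
    (∫ x, f x * g x ∂μ) ^ 2 ≤ (∫ x, f x ^ 2 ∂μ) * ∫ x, g x ^ 2 ∂μ := by
  have hfg : Integrable (fun x => f x * g x) μ := hf.integrable_mul hg
  have h (t : ℝ) : 0 ≤ (∫ x, f x ^ 2 ∂μ) * (t * t) + (2 * ∫ x, f x * g x ∂μ) * t
      + ∫ x, g x ^ 2 ∂μ := by
    have e : (∫ x, f x ^ 2 ∂μ) * (t * t) + (2 * ∫ x, f x * g x ∂μ) * t + ∫ x, g x ^ 2 ∂μ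
        = ∫ x, (t * f x + g x) ^ 2 ∂μ := by
      have : (fun x => (t * f x + g x) ^ 2)
          = fun x => (t * t) * f x ^ 2 + (2 * t) * (f x * g x) + g x ^ 2 := by
        funext x; ring
      have h1 : Integrable (fun x => (t * t) * f x ^ 2) μ := hf.integrable_sq.const_mul _
      have h2 : Integrable (fun x => (2 * t) * (f x * g x)) μ := hfg.const_mul _
      rw [this, integral_add (f := fun x => (t * t) * f x ^ 2 + (2 * t) * (f x * g x)) (h1.add h2)
        hg.integrable_sq, integral_add h1 h2, integral_const_mul, integral_const_mul]
      ring
    rw [e]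
    exact integral_nonneg fun x => sq_nonneg _
  have := discrim_le_zero h
  rw [discrim] at this
  linarith

lemma sq_pow_sub_pow_le (a b : ℝ) (m : ℕ) :
    (a ^ m - b ^ m) ^ 2 ≤ m ^ 2 * ((a - b) ^ 2 * (a ^ 2) ^ (m - 1)
      + (a - b) ^ 2 * (b ^ 2) ^ (m - 1)) := by
  have h := abs_pow_sub_pow_le a b m
  have h2 : (max |a| |b| ^ (m - 1)) ^ 2 ≤ (a ^ 2) ^ (m - 1) + (b ^ 2) ^ (m - 1) := by
    have ha : 0 ≤ (a ^ 2) ^ (m - 1) := by positivity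
    have hb : 0 ≤ (b ^ 2) ^ (m - 1) := by positivity
    rcases max_cases |a| |b| with ⟨h, _⟩ | ⟨h, _⟩ <;> rw [h, pow_right_comm, sq_abs] <;> linarith
  calc (a ^ m - b ^ m) ^ 2 = |a ^ m - b ^ m| ^ 2 := (sq_abs _).symm
    _ ≤ (|a - b| * m * max |a| |b| ^ (m - 1)) ^ 2 := by gcongr
    _ = m ^ 2 * ((a - b) ^ 2 * (max |a| |b| ^ (m - 1)) ^ 2) := by
      rw [mul_pow, mul_pow, sq_abs]; ring
    _ ≤ m ^ 2 * ((a - b) ^ 2 * ((a ^ 2) ^ (m - 1) + (b ^ 2) ^ (m - 1))) := by gcongr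
    _ = _ := by ring

lemma mul_pow_pred_le {s t c : ℝ} (hs : 0 ≤ s) (ht : 0 ≤ t) (hc : 0 ≤ c) {m : ℕ} (hm : 1 ≤ m) :
    c * (t * s ^ (m - 1)) ≤ (1 / 2) * s ^ m + (2 * c) ^ m * t ^ m := by
  obtain ⟨m, rfl⟩ : ∃ j, m = j + 1 := ⟨m - 1, by omega⟩
  simp only [Nat.add_sub_cancel]
  rcases le_total (2 * c * t) s with h | h
  · have h1 : (2 * c * t) * s ^ m ≤ s * s ^ m := by gcongr
    have h2 : 0 ≤ (2 * c) ^ (m + 1) * t ^ (m + 1) := by positivity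
    rw [pow_succ s]
    linarith
  · have h1 : (2 * c * t) * s ^ m ≤ (2 * c * t) * (2 * c * t) ^ m := by gcongr
    have h2 : 0 ≤ s ^ (m + 1) := by positivity
    have h3 : 0 ≤ (2 * c * t) * s ^ m := by positivity
    rw [← mul_pow, pow_succ (2 * c * t)]
    linarith

lemma integrable_pow_of_even {X : Type*} [MeasurableSpace X] {μ : Measure X} [IsFiniteMeasure μ]
    {f : X → ℝ} (hf : AEStronglyMeasurable f μ) {n j : ℕ} (hn : Even n) (hj : j ≤ n)
    (hfn : Integrable (fun x => f x ^ n) μ) : Integrable (fun x => f x ^ j) μ := by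
  refine ((integrable_const (1 : ℝ)).add hfn).mono' (hf.pow j) (.of_forall fun x => ?_)
  rw [Real.norm_eq_abs, abs_pow]
  simp only [Pi.add_apply]
  rw [← hn.pow_abs (f x)]
  rcases le_total |f x| 1 with h | h
  · have := pow_le_one₀ (n := j) (abs_nonneg _) h
    have : 0 ≤ |f x| ^ n := by positivity
    linarith
  · have := pow_le_pow_right₀ h hj
    linarith

variable {ι E : Type*} [Fintype ι] [DecidableEq ι]

/-- The sum of the squared increments of `F` under resampling of a single coordinate. -/
noncomputable def jumpSq (F : (ι → E) → ℝ) (p : ι → E × E) : ℝ :=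
  ∑ k, (F (resample ∅ p) - F (resample {k} p)) ^ 2

lemma jumpSq_nonneg (F : (ι → E) → ℝ) (p : ι → E × E) : 0 ≤ jumpSq F p :=
  Finset.sum_nonneg fun _ _ => sq_nonneg _

variable [MeasurableSpace E] {ν : ι → Measure E} [∀ k, IsProbabilityMeasure (ν k)] {F : (ι → E) → ℝ}

lemma integrable_sub_pow (hF : AEStronglyMeasurable F (Measure.pi ν)) {m : ℕ}
    (hFi : Integrable (fun x => F x ^ (2 * m)) (Measure.pi ν)) (s t : Finset ι) :
    Integrable (fun p => (F (resample s p) - F (resample t p)) ^ (2 * m)) (doubled ν) := by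
  have hS (s : Finset ι) : AEStronglyMeasurable (fun p => F (resample s p)) (doubled ν) :=
    hF.comp_measurePreserving (measurePreserving_resample ν s)
  have hI (s : Finset ι) : Integrable (fun p => F (resample s p) ^ (2 * m)) (doubled ν) :=
    (measurePreserving_resample ν s).integrable_comp_of_integrable hFi
  refine (((hI s).add (hI t)).const_mul (2 ^ (2 * m - 1))).mono' (((hS s).sub (hS t)).pow _)
    (.of_forall fun p => ?_)
  have he : Even (2 * m) := even_two_mul m
  rw [Real.norm_eq_abs, abs_of_nonneg (he.pow_nonneg _), sub_eq_add_neg]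
  refine he.add_pow_le.trans (le_of_eq ?_)
  simp only [Pi.add_apply, he.neg_pow]

lemma integrable_jumpSq_pow (hF : AEStronglyMeasurable F (Measure.pi ν)) {m : ℕ} (hm : 1 ≤ m)
    (hFi : Integrable (fun x => F x ^ (2 * m)) (Measure.pi ν)) :
    Integrable (fun p => jumpSq F p ^ m) (doubled ν) := by
  have hS (s : Finset ι) : AEStronglyMeasurable (fun p => F (resample s p)) (doubled ν) :=
    hF.comp_measurePreserving (measurePreserving_resample ν s)
  have hV : AEStronglyMeasurable (fun p => jumpSq F p) (doubled ν) := by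
    unfold jumpSq
    exact Finset.aestronglyMeasurable_fun_sum _ fun k _ => ((hS _).sub (hS _)).pow 2
  refine ((integrable_finsetSum Finset.univ fun k _ =>
    integrable_sub_pow hF hFi ∅ {k}).const_mul ((Finset.univ : Finset ι).card ^ (m - 1) : ℝ)).mono'
    (hV.pow m) (.of_forall fun p => ?_)
  rw [Real.norm_eq_abs, abs_of_nonneg (pow_nonneg (jumpSq_nonneg _ _) _)]
  obtain ⟨m, rfl⟩ : ∃ j, m = j + 1 := ⟨m - 1, by omega⟩
  rw [Nat.add_sub_cancel]
  refine (pow_sum_le_card_mul_sum_pow (fun _ _ => sq_nonneg _) m).trans (le_of_eq ?_)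
  simp only [← pow_mul]

lemma integral_pow_le_of_jumpSq (hF : AEStronglyMeasurable F (Measure.pi ν)) {m : ℕ} (hm : 1 ≤ m)
    (hFi : Integrable (fun x => F x ^ (2 * m)) (Measure.pi ν)) :
    ∫ x, F x ^ (2 * m) ∂(Measure.pi ν) ≤ 2 * (∫ x, F x ^ m ∂(Measure.pi ν)) ^ 2
      + 2 * (2 * (m : ℝ) ^ 2) ^ m * ∫ p, jumpSq F p ^ m ∂(doubled ν) := by
  have hS (s : Finset ι) : AEStronglyMeasurable (fun p => F (resample s p)) (doubled ν) :=
    hF.comp_measurePreserving (measurePreserving_resample ν s)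
  have hI (s : Finset ι) : Integrable (fun p => F (resample s p) ^ (2 * m)) (doubled ν) :=
    (measurePreserving_resample ν s).integrable_comp_of_integrable hFi
  have hL : MemLp (fun x => F x ^ m) 2 (Measure.pi ν) := by
    refine (memLp_two_iff_integrable_sq (hF.pow m)).2 ?_
    simpa only [Pi.pow_apply, ← pow_mul, mul_comm m 2] using hFi
  have hD (k : ι) (s : Finset ι) : Integrable (fun p => (F (resample ∅ p) - F (resample {k} p)) ^ 2
      * (F (resample s p) ^ 2) ^ (m - 1)) (doubled ν) := by
    refine ((integrable_sub_pow hF hFi ∅ {k}).add (hI s)).mono'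
      ((((hS _).sub (hS _)).pow 2).mul (((hS _).pow 2).pow _)) (.of_forall fun p => ?_)
    have h0 : 0 ≤ (F (resample ∅ p) - F (resample {k} p)) ^ 2
        * (F (resample s p) ^ 2) ^ (m - 1) := by positivity
    rw [Real.norm_eq_abs, abs_of_nonneg h0]
    simp only [Pi.add_apply, pow_mul]
    obtain ⟨j, rfl⟩ : ∃ j, m = j + 1 := ⟨m - 1, by omega⟩
    rw [Nat.add_sub_cancel]
    generalize (F (resample ∅ p) - F (resample {k} p)) = a
    generalize F (resample s p) = b
    have ha := sq_nonneg a
    have hb := sq_nonneg b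
    rcases le_total (a ^ 2) (b ^ 2) with h | h
    · have : a ^ 2 * (b ^ 2) ^ j ≤ b ^ 2 * (b ^ 2) ^ j := by gcongr
      have h2 : 0 ≤ (a ^ 2) ^ (j + 1) := by positivity
      rw [pow_succ' (b ^ 2)]; linarith
    · have : a ^ 2 * (b ^ 2) ^ j ≤ a ^ 2 * (a ^ 2) ^ j := by gcongr
      have h2 : 0 ≤ (b ^ 2) ^ (j + 1) := by positivity
      rw [pow_succ' (a ^ 2)]; linarith
  have hswap (k : ι) : ∫ p, (F (resample ∅ p) - F (resample {k} p)) ^ 2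
        * (F (resample {k} p) ^ 2) ^ (m - 1) ∂(doubled ν)
      = ∫ p, (F (resample ∅ p) - F (resample {k} p)) ^ 2
        * (F (resample ∅ p) ^ 2) ^ (m - 1) ∂(doubled ν) := by
    rw [← integral_comp_of_measurePreserving (measurePreserving_swapOn ν {k})
      (hD k {k}).aestronglyMeasurable]
    simp only [resample_swapOn, symmDiff_self, ← Finset.bot_eq_empty, bot_symmDiff]
    congr 1; funext p; ring
  have hES := efronStein hL
  have hk (k : ι) : ∫ p, (F (resample ∅ p) ^ m - F (resample {k} p) ^ m) ^ 2 ∂(doubled ν)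
      ≤ 2 * m ^ 2 * ∫ p, (F (resample ∅ p) - F (resample {k} p)) ^ 2
        * (F (resample ∅ p) ^ 2) ^ (m - 1) ∂(doubled ν) := by
    calc _ ≤ ∫ p, (m : ℝ) ^ 2 * ((F (resample ∅ p) - F (resample {k} p)) ^ 2
          * (F (resample ∅ p) ^ 2) ^ (m - 1) + (F (resample ∅ p) - F (resample {k} p)) ^ 2
          * (F (resample {k} p) ^ 2) ^ (m - 1)) ∂(doubled ν) := by
          refine integral_mono_of_nonneg (.of_forall fun p => sq_nonneg _)
            (((hD k ∅).add (hD k {k})).const_mul _) (.of_forall fun p => ?_)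
          exact sq_pow_sub_pow_le _ _ _
      _ = _ := by
          rw [integral_const_mul, integral_add (hD k ∅) (hD k {k}), hswap]
          ring
  have hsum : (1 / 2) * ∑ k, ∫ p, (F (resample ∅ p) ^ m - F (resample {k} p) ^ m) ^ 2 ∂(doubled ν)
      ≤ ∫ p, (m : ℝ) ^ 2 * (jumpSq F p * (F (resample ∅ p) ^ 2) ^ (m - 1)) ∂(doubled ν) := by
    have : ∫ p, (m : ℝ) ^ 2 * (jumpSq F p * (F (resample ∅ p) ^ 2) ^ (m - 1)) ∂(doubled ν)
        = ∑ k, (m : ℝ) ^ 2 * ∫ p, (F (resample ∅ p) - F (resample {k} p)) ^ 2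
          * (F (resample ∅ p) ^ 2) ^ (m - 1) ∂(doubled ν) := by
      rw [integral_const_mul, ← Finset.mul_sum, ← integral_finsetSum _ fun k _ => hD k ∅]
      simp only [jumpSq, Finset.sum_mul]
    rw [this, Finset.mul_sum]
    refine Finset.sum_le_sum fun k _ => ?_
    have := hk k
    linarith
  have hYoung : ∫ p, (m : ℝ) ^ 2 * (jumpSq F p * (F (resample ∅ p) ^ 2) ^ (m - 1)) ∂(doubled ν)
      ≤ (1 / 2) * ∫ x, F x ^ (2 * m) ∂(Measure.pi ν)
        + (2 * (m : ℝ) ^ 2) ^ m * ∫ p, jumpSq F p ^ m ∂(doubled ν) := by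
    rw [← integral_comp_of_measurePreserving (measurePreserving_resample ν ∅)
      hFi.aestronglyMeasurable, ← integral_const_mul, ← integral_const_mul,
      ← integral_add ((hI ∅).const_mul _) ((integrable_jumpSq_pow hF hm hFi).const_mul _)]
    refine integral_mono_of_nonneg (.of_forall fun p => ?_)
      (((hI ∅).const_mul _).add ((integrable_jumpSq_pow hF hm hFi).const_mul _))
      (.of_forall fun p => ?_)
    · have := jumpSq_nonneg F p
      simp only [Pi.zero_apply]
      positivity
    · simp only
      rw [pow_mul (F _)]
      exact mul_pow_pred_le (sq_nonneg _) (jumpSq_nonneg _ _) (by positivity) hm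
  have e1 : ∫ x, (F x ^ m) ^ 2 ∂(Measure.pi ν) = ∫ x, F x ^ (2 * m) ∂(Measure.pi ν) := by
    simp only [← pow_mul, mul_comm m 2]
  rw [e1] at hES
  linarith

lemma exists_integral_pow_fourteen_le : ∃ C : ℝ, 0 < C ∧
    ∀ {ι E : Type*} [Fintype ι] [DecidableEq ι] [MeasurableSpace E] {ν : ι → Measure E}
      [∀ k, IsProbabilityMeasure (ν k)] {F : (ι → E) → ℝ} {K : ℝ}, 0 < K →
      AEStronglyMeasurable F (Measure.pi ν) →
      Integrable (fun x => F x ^ 14) (Measure.pi ν) →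
      ∫ x, F x ∂(Measure.pi ν) = 0 →
      ∫ p, jumpSq F p ^ 7 ∂(doubled ν) ≤ K ^ 7 →
      ∫ x, F x ^ 14 ∂(Measure.pi ν) ≤ C * K ^ 7 := by
  refine ⟨?C, ?_, ?_⟩
  case C => exact 10 ^ 100
  · positivity
  intro ι E _ _ _ ν _ F K hK hF hFi h0 hV
  have hev : Even 14 := by decide
  have hFj {j : ℕ} (hj : j ≤ 14) : Integrable (fun x => F x ^ j) (Measure.pi ν) :=
    integrable_pow_of_even hF hev hj hFi
  have hVi : Integrable (fun p => jumpSq F p ^ 7) (doubled ν) :=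
    integrable_jumpSq_pow hF (by norm_num) hFi
  have hVm {m : ℕ} (hm : m ≤ 7) : ∫ p, jumpSq F p ^ m ∂(doubled ν) ≤ 2 * K ^ m := by
    have hb : Integrable (fun p => K ^ m * (1 + (K ^ 7)⁻¹ * jumpSq F p ^ 7)) (doubled ν) :=
      ((integrable_const (1 : ℝ)).add (hVi.const_mul _)).const_mul _
    calc _ ≤ ∫ p, K ^ m * (1 + (K ^ 7)⁻¹ * jumpSq F p ^ 7) ∂(doubled ν) := by
          refine integral_mono_of_nonneg
            (.of_forall fun p => pow_nonneg (jumpSq_nonneg _ _) _) hb (.of_forall fun p => ?_)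
          simp only
          have hv := jumpSq_nonneg F p
          rw [inv_mul_eq_div, ← div_pow]
          have e : jumpSq F p ^ m = K ^ m * (jumpSq F p / K) ^ m := by
            rw [← mul_pow, mul_div_cancel₀ _ hK.ne']
          rw [e]
          have ht : 0 ≤ jumpSq F p / K := by positivity
          generalize jumpSq F p / K = t at ht
          gcongr
          rcases le_total t 1 with h | h
          · have := pow_le_one₀ (n := m) ht h
            have : 0 ≤ t ^ 7 := by positivity
            linarith
          · have := pow_le_pow_right₀ h hm
            linarith
      _ = K ^ m * (1 + (K ^ 7)⁻¹ * ∫ p, jumpSq F p ^ 7 ∂(doubled ν)) := by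
          rw [integral_const_mul, integral_add (integrable_const _) (hVi.const_mul _),
            integral_const_mul]
          simp
      _ ≤ K ^ m * (1 + (K ^ 7)⁻¹ * K ^ 7) := by gcongr
      _ = 2 * K ^ m := by field_simp; norm_num
  have step {m : ℕ} (hm : 1 ≤ m) (hm7 : m ≤ 7) := integral_pow_le_of_jumpSq hF hm
    (hFj (j := 2 * m) (by omega))
  have hL {j : ℕ} (hj : 2 * j ≤ 14) : MemLp (fun x => F x ^ j) 2 (Measure.pi ν) := by
    refine (memLp_two_iff_integrable_sq (hF.pow j)).2 ?_
    simpa only [Pi.pow_apply, ← pow_mul, mul_comm j 2] using hFj hj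
  have cs {i j : ℕ} (hi : 2 * i ≤ 14) (hj : 2 * j ≤ 14) :
      (∫ x, F x ^ (i + j) ∂(Measure.pi ν)) ^ 2
        ≤ (∫ x, F x ^ (2 * i) ∂(Measure.pi ν)) * ∫ x, F x ^ (2 * j) ∂(Measure.pi ν) := by
    have := sq_integral_mul_le (hL hi) (hL hj)
    simpa only [← pow_mul, mul_comm _ 2, ← pow_add] using this
  have nn {j : ℕ} : 0 ≤ ∫ x, F x ^ (2 * j) ∂(Measure.pi ν) :=
    integral_nonneg fun x => (even_two_mul j).pow_nonneg _
  have b2 : ∫ x, F x ^ (2 * 1) ∂(Measure.pi ν) ≤ 8 * K := by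
    have h1 := step (m := 1) le_rfl (by norm_num)
    have h2 := hVm (m := 1) (by norm_num)
    simp only [pow_one, h0] at h1 h2
    norm_num at h1 ⊢
    linarith
  have b4 : ∫ x, F x ^ (2 * 2) ∂(Measure.pi ν) ≤ 10 ^ 3 * K ^ 2 := by
    have h1 := step (m := 2) (by norm_num) (by norm_num)
    have h2 := hVm (m := 2) (by norm_num)
    have h3 : (∫ x, F x ^ 2 ∂(Measure.pi ν)) ^ 2 ≤ (8 * K) ^ 2 := by gcongr
    norm_num at h1 ⊢
    nlinarith
  have b6 : ∫ x, F x ^ (2 * 3) ∂(Measure.pi ν) ≤ 10 ^ 6 * K ^ 3 := by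
    have h1 := step (m := 3) (by norm_num) (by norm_num)
    have h2 := hVm (m := 3) (by norm_num)
    have h3 := cs (i := 1) (j := 2) (by norm_num) (by norm_num)
    have h4 := mul_le_mul b2 b4 nn (by positivity)
    have h5 := h3.trans h4
    norm_num at h1 h5 ⊢
    nlinarith
  have b8 : ∫ x, F x ^ (2 * 4) ∂(Measure.pi ν) ≤ 10 ^ 8 * K ^ 4 := by
    have h1 := step (m := 4) (by norm_num) (by norm_num)
    have h2 := hVm (m := 4) (by norm_num)
    have h3 : (∫ x, F x ^ 4 ∂(Measure.pi ν)) ^ 2 ≤ (10 ^ 3 * K ^ 2) ^ 2 := by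
      gcongr
    norm_num at h1 ⊢
    nlinarith
  have h1 := step (m := 7) (by norm_num) (by norm_num)
  have h3 := cs (i := 3) (j := 4) (by norm_num) (by norm_num)
  have h5 := h3.trans (mul_le_mul b6 b8 nn (by positivity))
  have hK7 : 0 < K ^ 7 := by positivity
  norm_num at h1 h5 ⊢
  nlinarith

end MomentInequality

section QuadraticForm

variable {ι : Type*} [Fintype ι]

lemma sq_dotProduct_le (v w : ι → ℝ) (s : Finset ι) (hv : ∀ p ∉ s, v p = 0) :
    (v ⬝ᵥ w) ^ 2 ≤ (∑ p, v p ^ 2) * ∑ p ∈ s, w p ^ 2 := by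
  have e1 : v ⬝ᵥ w = ∑ p ∈ s, v p * w p :=
    (Finset.sum_subset (Finset.subset_univ s) fun p _ hp => by simp [hv p hp]).symm
  have e2 : ∑ p, v p ^ 2 = ∑ p ∈ s, v p ^ 2 :=
    (Finset.sum_subset (Finset.subset_univ s) fun p _ hp => by simp [hv p hp]).symm
  rw [e1, e2]
  exact Finset.sum_mul_sq_le_sq_mul_sq s v w

variable [DecidableEq ι]

lemma sum_sq_mulVec_le {A : Matrix ι ι ℝ} (hA : ‖A‖ ≤ 1) (v : ι → ℝ) :
    ∑ p, (A *ᵥ v) p ^ 2 ≤ ∑ p, v p ^ 2 := by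
  have h := Matrix.l2_opNorm_mulVec A (WithLp.toLp 2 v)
  have h2 : ‖WithLp.toLp 2 (A *ᵥ v)‖ ≤ ‖WithLp.toLp 2 v‖ :=
    h.trans (mul_le_of_le_one_left (norm_nonneg _) hA)
  have h3 := pow_le_pow_left₀ (norm_nonneg _) h2 2
  simpa [EuclideanSpace.norm_sq_eq] using h3

lemma abs_quadForm_le {A : Matrix ι ι ℝ} (hA : ‖A‖ ≤ 1) (v : ι → ℝ) :
    |v ⬝ᵥ (A *ᵥ v)| ≤ ∑ p, v p ^ 2 := by
  have h0 : 0 ≤ ∑ p, v p ^ 2 := Finset.sum_nonneg fun _ _ => sq_nonneg _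
  refine abs_le_of_sq_le_sq ?_ h0
  refine (sq_dotProduct_le v (A *ᵥ v) Finset.univ (by simp)).trans ?_
  rw [sq]
  exact mul_le_mul_of_nonneg_left (sum_sq_mulVec_le hA v) h0

lemma norm_transpose_le {A : Matrix ι ι ℝ} (hA : ‖A‖ ≤ 1) : ‖Aᵀ‖ ≤ 1 := by
  rw [← Matrix.conjTranspose_eq_transpose_of_trivial, Matrix.l2_opNorm_conjTranspose]
  exact hA

lemma sq_quadForm_sub_le {A : Matrix ι ι ℝ} (hA : ‖A‖ ≤ 1) (y δ : ι → ℝ) (s : Finset ι)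
    (hδ : ∀ p ∉ s, δ p = 0) :
    (y ⬝ᵥ (A *ᵥ y) - (y - δ) ⬝ᵥ (A *ᵥ (y - δ))) ^ 2
      ≤ 3 * ((∑ p, δ p ^ 2) * ∑ p ∈ s, ((A *ᵥ y) p ^ 2 + (Aᵀ *ᵥ y) p ^ 2)
        + (∑ p, δ p ^ 2) ^ 2) := by
  have e : y ⬝ᵥ (A *ᵥ y) - (y - δ) ⬝ᵥ (A *ᵥ (y - δ))
      = δ ⬝ᵥ (A *ᵥ y) + δ ⬝ᵥ (Aᵀ *ᵥ y) - δ ⬝ᵥ (A *ᵥ δ) := by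
    have : δ ⬝ᵥ (Aᵀ *ᵥ y) = y ⬝ᵥ (A *ᵥ δ) := by
      rw [Matrix.mulVec_transpose, dotProduct_comm, Matrix.dotProduct_mulVec]
    rw [this, Matrix.mulVec_sub, sub_dotProduct, dotProduct_sub, dotProduct_sub]
    ring
  have h1 := sq_dotProduct_le δ (A *ᵥ y) s hδ
  have h2 := sq_dotProduct_le δ (Aᵀ *ᵥ y) s hδ
  have h3 : (δ ⬝ᵥ (A *ᵥ δ)) ^ 2 ≤ (∑ p, δ p ^ 2) ^ 2 :=
    sq_le_sq' (abs_le.1 (abs_quadForm_le hA δ)).1 (abs_le.1 (abs_quadForm_le hA δ)).2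
  rw [e, Finset.sum_add_distrib, mul_add]
  generalize δ ⬝ᵥ (A *ᵥ y) = a at *
  generalize δ ⬝ᵥ (Aᵀ *ᵥ y) = b at *
  generalize δ ⬝ᵥ (A *ᵥ δ) = c at *
  nlinarith [sq_nonneg (a - b), sq_nonneg (a + c), sq_nonneg (b + c)]

/-- The pairs in which the index `k` occurs. -/
def pairsThrough {d : ℕ} (k : Fin d) : Finset (PairIdx d) :=
  Finset.univ.filter fun p => p.1.1 = k ∨ p.1.2 = k

lemma card_pairsThrough_le {d : ℕ} (k : Fin d) : (pairsThrough k).card ≤ 2 * d := by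
  have h : (pairsThrough k).card
      ≤ (Finset.univ.image (fun l : Fin d => (k, l)) ∪
        Finset.univ.image (fun l : Fin d => (l, k))).card := by
    refine Finset.card_le_card_of_injOn Subtype.val ?_ Subtype.val_injective.injOn
    rintro ⟨⟨a, b⟩, hab⟩ hp
    simp only [pairsThrough, Finset.coe_filter, Finset.mem_univ, true_and, Set.mem_ofPred_eq] at hp
    simp only [Finset.coe_union, Finset.coe_image, Set.mem_union, Set.mem_image]
    rcases hp with rfl | rfl
    · exact Or.inl ⟨b, by simp, rfl⟩
    · exact Or.inr ⟨a, by simp, rfl⟩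
  refine h.trans ((Finset.card_union_le _ _).trans ?_)
  have h1 := Finset.card_image_le (s := Finset.univ) (f := fun l : Fin d => (k, l))
  have h2 := Finset.card_image_le (s := Finset.univ) (f := fun l : Fin d => (l, k))
  simp only [Finset.card_univ, Fintype.card_fin] at h1 h2
  omega

lemma sum_pairsThrough_le {d : ℕ} (w : PairIdx d → ℝ) (hw : ∀ p, 0 ≤ w p) :
    ∑ k, ∑ p ∈ pairsThrough k, w p ≤ 2 * ∑ p, w p := by
  simp only [pairsThrough, Finset.sum_filter]
  rw [Finset.sum_comm, Finset.mul_sum]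
  refine Finset.sum_le_sum fun p _ => ?_
  calc ∑ k, (if p.1.1 = k ∨ p.1.2 = k then w p else 0)
      ≤ ∑ k, ((if p.1.1 = k then w p else 0) + (if p.1.2 = k then w p else 0)) := by
        refine Finset.sum_le_sum fun k _ => ?_
        have := hw p
        split_ifs <;> simp_all
    _ = 2 * w p := by rw [Finset.sum_add_distrib]; simp; ring

lemma card_pairIdx_le (d : ℕ) : Fintype.card (PairIdx d) ≤ d ^ 2 := by
  refine (Fintype.card_subtype_le _).trans ?_
  simp [sq]

lemma sum_sq_quadForm_sub_pow_le {d : ℕ} (hd : 1 ≤ d)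
    {A : Matrix (PairIdx d) (PairIdx d) ℝ} (hA : ‖A‖ ≤ 1) (y : PairIdx d → ℝ)
    (δ : Fin d → PairIdx d → ℝ) (hδ : ∀ k, ∀ p ∉ pairsThrough k, δ k p = 0) :
    (∑ k, (y ⬝ᵥ (A *ᵥ y) - (y - δ k) ⬝ᵥ (A *ᵥ (y - δ k))) ^ 2) ^ 7
      ≤ 2 ^ 6 * 12 ^ 7 * ∑ k, (2 * (d : ℝ) ^ 7 * (∑ p, δ k p ^ 2) ^ 14
        + ((d : ℝ) ^ 7)⁻¹ * (∑ p, y p ^ 2) ^ 14) := by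
  set u : Fin d → ℝ := fun k => ∑ p, δ k p ^ 2 with hu
  set W : ℝ := ∑ p, y p ^ 2 with hW
  have hu0 (k) : 0 ≤ u k := Finset.sum_nonneg fun _ _ => sq_nonneg _
  have hW0 : 0 ≤ W := Finset.sum_nonneg fun _ _ => sq_nonneg _
  have hd1 : (1 : ℝ) ≤ d := by exact_mod_cast hd
  have : Nonempty (Fin d) := ⟨⟨0, hd⟩⟩
  obtain ⟨k₀, -, hk₀⟩ := Finset.exists_max_image Finset.univ u Finset.univ_nonempty
  have hV : ∑ k, (y ⬝ᵥ (A *ᵥ y) - (y - δ k) ⬝ᵥ (A *ᵥ (y - δ k))) ^ 2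
      ≤ 12 * (u k₀ * W) + 12 * ∑ k, u k ^ 2 := by
    have hb : ∑ k, ∑ p ∈ pairsThrough k, ((A *ᵥ y) p ^ 2 + (Aᵀ *ᵥ y) p ^ 2) ≤ 4 * W := by
      refine (sum_pairsThrough_le _ fun p => by positivity).trans ?_
      rw [Finset.sum_add_distrib]
      have h1 := sum_sq_mulVec_le hA y
      have h2 := sum_sq_mulVec_le (norm_transpose_le hA) y
      linarith
    have hs : 0 ≤ ∑ k, u k ^ 2 := Finset.sum_nonneg fun _ _ => sq_nonneg _
    calc _ ≤ ∑ k, 3 * (u k₀ * ∑ p ∈ pairsThrough k, ((A *ᵥ y) p ^ 2 + (Aᵀ *ᵥ y) p ^ 2)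
          + u k ^ 2) := by
          refine Finset.sum_le_sum fun k _ => (sq_quadForm_sub_le hA y (δ k) _ (hδ k)).trans ?_
          have := hk₀ k (Finset.mem_univ k)
          have h4 : 0 ≤ ∑ p ∈ pairsThrough k, ((A *ᵥ y) p ^ 2 + (Aᵀ *ᵥ y) p ^ 2) :=
            Finset.sum_nonneg fun _ _ => by positivity
          have : u k * ∑ p ∈ pairsThrough k, ((A *ᵥ y) p ^ 2 + (Aᵀ *ᵥ y) p ^ 2)
            ≤ u k₀ * ∑ p ∈ pairsThrough k, ((A *ᵥ y) p ^ 2 + (Aᵀ *ᵥ y) p ^ 2) := by gcongr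
          gcongr
      _ = 3 * (u k₀ * ∑ k, ∑ p ∈ pairsThrough k, ((A *ᵥ y) p ^ 2 + (Aᵀ *ᵥ y) p ^ 2))
          + 3 * ∑ k, u k ^ 2 := by
          rw [← Finset.mul_sum, Finset.sum_add_distrib, ← Finset.mul_sum]; ring
      _ ≤ 3 * (u k₀ * (4 * W)) + 12 * ∑ k, u k ^ 2 := by
          have := hu0 k₀
          gcongr
          norm_num
      _ = _ := by ring
  have hS : (∑ k, u k ^ 2) ^ 7 ≤ d ^ 7 * ∑ k, u k ^ 14 := by
    have h := pow_sum_le_card_mul_sum_pow (s := Finset.univ) (f := fun k => u k ^ 2)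
      (fun _ _ => sq_nonneg _) 6
    simp only [Finset.card_univ, Fintype.card_fin, ← pow_mul] at h
    norm_num at h
    refine h.trans ?_
    have h14 : 0 ≤ ∑ k, u k ^ 14 := Finset.sum_nonneg fun k _ => pow_nonneg (hu0 k) _
    exact mul_le_mul_of_nonneg_right (pow_le_pow_right₀ hd1 (by norm_num)) h14
  have hUW : (u k₀ * W) ^ 7 ≤ ∑ k, (d ^ 7 * u k ^ 14 + ((d : ℝ) ^ 7)⁻¹ * W ^ 14) := by
    have hAG : (u k₀ * W) ^ 7 ≤ d ^ 7 * u k₀ ^ 14 + ((d : ℝ) ^ 7)⁻¹ * W ^ 14 := by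
      have hD : 0 < (d : ℝ) ^ 7 := by positivity
      have hx : 0 ≤ u k₀ ^ 7 := pow_nonneg (hu0 _) _
      have hy : 0 ≤ W ^ 7 := pow_nonneg hW0 _
      rw [mul_pow, show u k₀ ^ 14 = (u k₀ ^ 7) ^ 2 by ring, show W ^ 14 = (W ^ 7) ^ 2 by ring]
      generalize u k₀ ^ 7 = a at *
      generalize W ^ 7 = b at *
      generalize (d : ℝ) ^ 7 = D at *
      have h : 0 ≤ D⁻¹ * (D * a - b) ^ 2 := by positivity
      have e : D⁻¹ * (D * a - b) ^ 2 = D * a ^ 2 + D⁻¹ * b ^ 2 - 2 * (a * b) := by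
        field_simp
        ring
      have : 0 ≤ a * b := by positivity
      linarith
    refine hAG.trans ?_
    exact Finset.single_le_sum (f := fun k => d ^ 7 * u k ^ 14 + ((d : ℝ) ^ 7)⁻¹ * W ^ 14)
      (fun k _ => by have := hu0 k; positivity) (Finset.mem_univ k₀)
  have h0 : 0 ≤ ∑ k, u k ^ 2 := Finset.sum_nonneg fun _ _ => sq_nonneg _
  have h00 : 0 ≤ u k₀ * W := mul_nonneg (hu0 _) hW0
  have h7 {a b : ℝ} (ha : 0 ≤ a) (hb : 0 ≤ b) :
      (12 * a + 12 * b) ^ 7 ≤ 2 ^ 6 * 12 ^ 7 * (a ^ 7 + b ^ 7) := by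
    have := add_pow_le ha hb 7
    rw [← mul_add, mul_pow]
    norm_num at this ⊢
    linarith
  calc _ ≤ (12 * (u k₀ * W) + 12 * ∑ k, u k ^ 2) ^ 7 :=
        pow_le_pow_left₀ (Finset.sum_nonneg fun _ _ => sq_nonneg _) hV 7
    _ ≤ 2 ^ 6 * 12 ^ 7 * ((u k₀ * W) ^ 7 + (∑ k, u k ^ 2) ^ 7) := h7 h00 h0
    _ ≤ 2 ^ 6 * 12 ^ 7 * (∑ k, (d ^ 7 * u k ^ 14 + ((d : ℝ) ^ 7)⁻¹ * W ^ 14)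
        + d ^ 7 * ∑ k, u k ^ 14) :=
        mul_le_mul_of_nonneg_left (add_le_add hUW hS) (by norm_num)
    _ = _ := by
        rw [Finset.mul_sum _ _ ((d : ℝ) ^ 7), ← Finset.sum_add_distrib]
        congr 1
        refine Finset.sum_congr rfl fun k _ => ?_
        ring

lemma pow_sum_sq_le {ι : Type*} (s : Finset ι) (v : ι → ℝ) (n : ℕ) :
    (∑ p ∈ s, v p ^ 2) ^ (n + 1) ≤ (s.card : ℝ) ^ n * ∑ p ∈ s, v p ^ (2 * (n + 1)) := by
  simp only [pow_mul]
  exact pow_sum_le_card_mul_sum_pow (fun _ _ => sq_nonneg _) n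

lemma sum_sq_pow_fourteen_le {d : ℕ} (v : PairIdx d → ℝ) :
    (∑ p, v p ^ 2) ^ 14 ≤ ((d : ℝ) ^ 2) ^ 13 * ∑ p, v p ^ 28 := by
  have hc : (Fintype.card (PairIdx d) : ℝ) ≤ (d : ℝ) ^ 2 := by exact_mod_cast card_pairIdx_le d
  refine (pow_sum_sq_le Finset.univ v 13).trans (mul_le_mul_of_nonneg_right
    (pow_le_pow_left₀ (by positivity) hc 13) (Finset.sum_nonneg fun p _ => ?_))
  exact (show Even 28 by decide).pow_nonneg _

lemma sum_sq_pow_fourteen_le_of_through {d : ℕ} (k : Fin d) (v : PairIdx d → ℝ)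
    (hv : ∀ p ∉ pairsThrough k, v p = 0) :
    (∑ p, v p ^ 2) ^ 14 ≤ (2 * (d : ℝ)) ^ 13 * ∑ p ∈ pairsThrough k, v p ^ 28 := by
  have e2 : ∑ p, v p ^ 2 = ∑ p ∈ pairsThrough k, v p ^ 2 :=
    (Finset.sum_subset (Finset.subset_univ _) fun p _ hp => by simp [hv p hp]).symm
  have hc : ((pairsThrough k).card : ℝ) ≤ 2 * (d : ℝ) := by exact_mod_cast card_pairsThrough_le k
  rw [e2]
  refine (pow_sum_sq_le (pairsThrough k) v 13).trans (mul_le_mul_of_nonneg_right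
    (pow_le_pow_left₀ (by positivity) hc 13) (Finset.sum_nonneg fun p _ => ?_))
  exact (show Even 28 by decide).pow_nonneg _

end QuadraticForm

section TensorMoments

variable {d : ℕ}

lemma abs_reducedTensor_le (v : Fin d → ℝ) (p : PairIdx d) :
    |reducedTensor v p| ≤ v p.1.1 ^ 2 + v p.1.2 ^ 2 := by
  unfold reducedTensor
  split_ifs with h
  · rw [abs_mul, abs_mul, abs_of_nonneg (Real.sqrt_nonneg 2)]
    have h1 : √2 ≤ 2 := by
      rw [Real.sqrt_le_left (by norm_num)]; norm_num
    have h2 : 0 ≤ |v p.1.1| * |v p.1.2| := by positivity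
    have h3 := mul_le_mul_of_nonneg_right h1 h2
    rw [← sq_abs (v p.1.1), ← sq_abs (v p.1.2), mul_assoc]
    nlinarith [sq_nonneg (|v p.1.1| - |v p.1.2|)]
  · rw [abs_of_nonneg (by positivity), sq_abs]
    nlinarith [sq_nonneg (v p.1.2)]

lemma continuous_reducedTensor (p : PairIdx d) :
    Continuous fun v : Fin d → ℝ => reducedTensor v p := by
  unfold reducedTensor
  split_ifs <;> fun_prop

lemma add_pow_twentyEight_le (a b : ℝ) : (a + b) ^ 28 ≤ 2 ^ 27 * (a ^ 28 + b ^ 28) :=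
  Even.add_pow_le (n := 28) (by decide)

lemma sub_pow_twentyEight_le (a b : ℝ) : (a - b) ^ 28 ≤ 2 ^ 27 * (a ^ 28 + b ^ 28) := by
  have h := add_pow_twentyEight_le a (-b)
  rwa [← sub_eq_add_neg, (show Even 28 by decide).neg_pow] at h

lemma pow_twentyEight_nonneg (a : ℝ) : 0 ≤ a ^ 28 := (show Even 28 by decide).pow_nonneg a

lemma reducedTensor_pow_le (v : Fin d → ℝ) (p : PairIdx d) :
    reducedTensor v p ^ 28 ≤ 2 ^ 27 * (v p.1.1 ^ 56 + v p.1.2 ^ 56) := by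
  have h := add_pow_twentyEight_le (v p.1.1 ^ 2) (v p.1.2 ^ 2)
  rw [← pow_mul, ← pow_mul] at h
  refine le_trans ?_ h
  rw [← (show Even 28 by decide).pow_abs]
  exact pow_le_pow_left₀ (abs_nonneg _) (abs_reducedTensor_le v p) 28

variable {ν : Fin d → Measure ℝ} [∀ k, IsProbabilityMeasure (ν k)] {M : ℝ}

lemma reducedTensor_moment (hI : ∀ k, Integrable (fun x : ℝ => x ^ 56) (ν k))
    (hM : ∀ k, ∫ x, x ^ 56 ∂(ν k) ≤ M) (p : PairIdx d) :
    Integrable (fun v => reducedTensor v p ^ 28) (Measure.pi ν) ∧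
      ∫ v, reducedTensor v p ^ 28 ∂(Measure.pi ν) ≤ 2 ^ 28 * M := by
  have hk (k : Fin d) : Integrable (fun v : Fin d → ℝ => v k ^ 56) (Measure.pi ν) :=
    (measurePreserving_eval ν k).integrable_comp_of_integrable (hI k)
  have hm (k : Fin d) : ∫ v, v k ^ 56 ∂(Measure.pi ν) ≤ M :=
    (integral_comp_of_measurePreserving (measurePreserving_eval ν k)
      (hI k).aestronglyMeasurable).le.trans (hM k)
  have hb : Integrable (fun v : Fin d → ℝ => 2 ^ 27 * (v p.1.1 ^ 56 + v p.1.2 ^ 56))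
    (Measure.pi ν) := ((hk _).add (hk _)).const_mul _
  refine ⟨hb.mono' ((continuous_reducedTensor p).pow 28).aestronglyMeasurable
    (.of_forall fun v => ?_), ?_⟩
  · rw [Real.norm_eq_abs, abs_of_nonneg (pow_twentyEight_nonneg _)]
    exact reducedTensor_pow_le v p
  · refine (integral_mono_of_nonneg (.of_forall fun v => pow_twentyEight_nonneg _) hb
      (.of_forall fun v => reducedTensor_pow_le v p)).trans ?_
    rw [integral_const_mul, integral_add (hk _) (hk _)]
    have h1 := hm p.1.1
    have h2 := hm p.1.2
    linarith

/-- A bound for the moments of order 28 of the entries of the centered tensor and of their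
increments, in terms of a bound for the moments of order 56 of the coordinates. -/
def entryBound (M : ℝ) : ℝ := 2 ^ 27 * (2 * (2 ^ 28 * M) + (1 + 2 ^ 28 * M) ^ 28)

lemma entryBound_pos (hM0 : 0 ≤ M) : 0 < entryBound M := by
  unfold entryBound; positivity

lemma integrable_reducedTensor (hI : ∀ k, Integrable (fun x : ℝ => x ^ 56) (ν k)) {j : ℕ}
    (hj : j ≤ 28) (p : PairIdx d) :
    Integrable (fun v => reducedTensor v p ^ j) (Measure.pi ν) := by
  have hi : Integrable (fun v => reducedTensor v p ^ 28) (Measure.pi ν) := by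
    have hk (k : Fin d) : Integrable (fun v : Fin d → ℝ => v k ^ 56) (Measure.pi ν) :=
      (measurePreserving_eval ν k).integrable_comp_of_integrable (hI k)
    refine (((hk p.1.1).add (hk p.1.2)).const_mul (2 ^ 27)).mono'
      ((continuous_reducedTensor p).pow 28).aestronglyMeasurable (.of_forall fun v => ?_)
    rw [Real.norm_eq_abs, abs_of_nonneg (pow_twentyEight_nonneg _)]
    exact reducedTensor_pow_le v p
  exact integrable_pow_of_even (continuous_reducedTensor p).aestronglyMeasurable
    (by decide) hj hi

lemma abs_integral_reducedTensor_le (hI : ∀ k, Integrable (fun x : ℝ => x ^ 56) (ν k))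
    (hM : ∀ k, ∫ x, x ^ 56 ∂(ν k) ≤ M) (p : PairIdx d) :
    |∫ v, reducedTensor v p ∂(Measure.pi ν)| ≤ 1 + 2 ^ 28 * M := by
  obtain ⟨h1, h2⟩ := reducedTensor_moment hI hM p
  refine abs_integral_le_integral_abs.trans ?_
  refine (integral_mono_of_nonneg (.of_forall fun v => abs_nonneg _)
    ((integrable_const (1 : ℝ)).add h1) (.of_forall fun v => ?_)).trans ?_
  · simp only [Pi.add_apply]
    rw [← (show Even 28 by decide).pow_abs (reducedTensor v p)]
    have := abs_nonneg (reducedTensor v p)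
    generalize |reducedTensor v p| = t at *
    rcases le_total t 1 with h | h
    · have := pow_nonneg this 28
      linarith
    · have := le_self_pow₀ h (n := 28) (by norm_num)
      linarith
  · simp only [Pi.add_apply]
    rw [integral_add (integrable_const _) h1]
    simpa using h2

lemma centeredTensor_moment (hI : ∀ k, Integrable (fun x : ℝ => x ^ 56) (ν k))
    (hM : ∀ k, ∫ x, x ^ 56 ∂(ν k) ≤ M) (hM0 : 0 ≤ M) (p : PairIdx d) :
    Integrable (fun v => centeredTensor (Measure.pi ν) id v p ^ 28) (Measure.pi ν) ∧
      ∫ v, centeredTensor (Measure.pi ν) id v p ^ 28 ∂(Measure.pi ν) ≤ entryBound M := by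
  obtain ⟨h1, h2⟩ := reducedTensor_moment hI hM p
  have h3 := abs_integral_reducedTensor_le hI hM p
  simp only [centeredTensor, id]
  generalize ∫ v, reducedTensor v p ∂(Measure.pi ν) = c at *
  have hc : c ^ 28 ≤ (1 + 2 ^ 28 * M) ^ 28 := by
    rw [← (show Even 28 by decide).pow_abs]
    exact pow_le_pow_left₀ (abs_nonneg _) h3 28
  have hb : Integrable (fun v => 2 ^ 27 * (reducedTensor v p ^ 28 + c ^ 28)) (Measure.pi ν) :=
    (h1.add (integrable_const _)).const_mul _
  refine ⟨hb.mono' (((continuous_reducedTensor p).sub continuous_const).pow 28).aestronglyMeasurable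
    (.of_forall fun v => ?_), ?_⟩
  · rw [Real.norm_eq_abs, abs_of_nonneg (pow_twentyEight_nonneg _)]
    exact sub_pow_twentyEight_le _ _
  · refine (integral_mono_of_nonneg (.of_forall fun v => pow_twentyEight_nonneg _) hb
      (.of_forall fun v => sub_pow_twentyEight_le _ _)).trans ?_
    rw [integral_const_mul, integral_add h1 (integrable_const _)]
    simp only [integral_const, probReal_univ, one_smul, entryBound]
    generalize (1 + 2 ^ 28 * M) ^ 28 = a at *
    linarith

/-- The increment of the reduced tensor square when the coordinate `k` is resampled. -/
noncomputable def tensorJump (k : Fin d) (q : Fin d → ℝ × ℝ) : PairIdx d → ℝ := fun p =>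
  reducedTensor (resample ∅ q) p - reducedTensor (resample {k} q) p

lemma tensorJump_eq_zero (k : Fin d) (q : Fin d → ℝ × ℝ) {p : PairIdx d}
    (hp : p ∉ pairsThrough k) : tensorJump k q p = 0 := by
  simp only [pairsThrough, Finset.mem_filter, Finset.mem_univ, true_and, not_or] at hp
  simp [tensorJump, reducedTensor, resample, hp.1, hp.2]

lemma tensorJump_moment (hI : ∀ k, Integrable (fun x : ℝ => x ^ 56) (ν k))
    (hM : ∀ k, ∫ x, x ^ 56 ∂(ν k) ≤ M) (k : Fin d) (p : PairIdx d) :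
    Integrable (fun q => tensorJump k q p ^ 28) (doubled ν) ∧
      ∫ q, tensorJump k q p ^ 28 ∂(doubled ν) ≤ entryBound M := by
  obtain ⟨h1, h2⟩ := reducedTensor_moment hI hM p
  have hS (s : Finset (Fin d)) :
      Integrable (fun q => reducedTensor (resample s q) p ^ 28) (doubled ν) :=
    (measurePreserving_resample ν s).integrable_comp_of_integrable h1
  have hm (s : Finset (Fin d)) :
      ∫ q, reducedTensor (resample s q) p ^ 28 ∂(doubled ν) ≤ 2 ^ 28 * M :=
    (integral_comp_of_measurePreserving (measurePreserving_resample ν s)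
      h1.aestronglyMeasurable).le.trans h2
  have hA (s : Finset (Fin d)) :
      AEStronglyMeasurable (fun q => reducedTensor (resample s q) p) (doubled ν) :=
    (continuous_reducedTensor p).aestronglyMeasurable.comp_measurePreserving
      (measurePreserving_resample ν s)
  have hb : Integrable (fun q => 2 ^ 27 * (reducedTensor (resample ∅ q) p ^ 28
      + reducedTensor (resample {k} q) p ^ 28)) (doubled ν) :=
    ((hS _).add (hS _)).const_mul _
  unfold tensorJump
  refine ⟨hb.mono' (((hA _).sub (hA _)).pow 28) (.of_forall fun v => ?_), ?_⟩
  · rw [Real.norm_eq_abs, abs_of_nonneg (pow_twentyEight_nonneg _)]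
    exact sub_pow_twentyEight_le _ _
  · refine (integral_mono_of_nonneg (.of_forall fun v => pow_twentyEight_nonneg _) hb
      (.of_forall fun v => sub_pow_twentyEight_le _ _)).trans ?_
    rw [integral_const_mul, integral_add (hS _) (hS _)]
    have h3 := hm ∅
    have h4 := hm {k}
    have h5 : 0 ≤ (1 + 2 ^ 28 * M) ^ 28 := pow_twentyEight_nonneg _
    unfold entryBound
    generalize (1 + 2 ^ 28 * M) ^ 28 = a at *
    linarith

end TensorMoments

section QuadraticFormMoments

variable {d : ℕ} {ν : Fin d → Measure ℝ} {M : ℝ}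

lemma continuous_centeredTensor :
    Continuous fun v : Fin d → ℝ => centeredTensor (Measure.pi ν) id v := by
  refine continuous_pi fun p => ?_
  exact (continuous_reducedTensor p).sub continuous_const

/-- The quadratic form of the centered tensor. -/
noncomputable def tensorForm (ν : Fin d → Measure ℝ) (A : Matrix (PairIdx d) (PairIdx d) ℝ)
    (v : Fin d → ℝ) : ℝ :=
  centeredTensor (Measure.pi ν) id v ⬝ᵥ (A *ᵥ centeredTensor (Measure.pi ν) id v)

lemma continuous_tensorForm (A : Matrix (PairIdx d) (PairIdx d) ℝ) :
    Continuous (tensorForm ν A) := by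
  have h := continuous_centeredTensor (ν := ν)
  unfold tensorForm
  exact h.dotProduct (continuous_const.matrix_mulVec h)

lemma tensorForm_pow_le {A : Matrix (PairIdx d) (PairIdx d) ℝ} (hA : ‖A‖ ≤ 1) (v : Fin d → ℝ) :
    tensorForm ν A v ^ 14 ≤ ((d : ℝ) ^ 2) ^ 13 *
      ∑ p, centeredTensor (Measure.pi ν) id v p ^ 28 := by
  rw [← (show Even 14 by decide).pow_abs]
  exact (pow_le_pow_left₀ (abs_nonneg _) (abs_quadForm_le hA _) 14).trans
    (sum_sq_pow_fourteen_le _)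

lemma jumpSq_sub_const {ι E : Type*} [Fintype ι] [DecidableEq ι] (F : (ι → E) → ℝ) (c : ℝ) :
    jumpSq (fun x => F x - c) = jumpSq F := by
  funext p
  simp [jumpSq]

lemma jumpSq_tensorForm_pow_le (hd : 1 ≤ d) {A : Matrix (PairIdx d) (PairIdx d) ℝ}
    (hA : ‖A‖ ≤ 1) (q : Fin d → ℝ × ℝ) :
    jumpSq (tensorForm ν A) q ^ 7 ≤ 2 ^ 6 * 12 ^ 7 * ∑ k, (2 * (d : ℝ) ^ 7 *
        ((2 * (d : ℝ)) ^ 13 * ∑ p ∈ pairsThrough k, tensorJump k q p ^ 28)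
      + ((d : ℝ) ^ 7)⁻¹ * (((d : ℝ) ^ 2) ^ 13 *
        ∑ p, centeredTensor (Measure.pi ν) id (resample ∅ q) p ^ 28)) := by
  have h := sum_sq_quadForm_sub_pow_le hd hA (centeredTensor (Measure.pi ν) id (resample ∅ q))
    (fun k => tensorJump k q) (fun k p hp => tensorJump_eq_zero k q hp)
  have e (k : Fin d) : centeredTensor (Measure.pi ν) id (resample ∅ q) - tensorJump k q
      = centeredTensor (Measure.pi ν) id (resample {k} q) := by
    funext p
    simp [centeredTensor, tensorJump]
  simp only [e] at h
  refine h.trans (mul_le_mul_of_nonneg_left (Finset.sum_le_sum fun k _ => add_le_add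
    (mul_le_mul_of_nonneg_left ?_ (by positivity))
    (mul_le_mul_of_nonneg_left ?_ (by positivity))) (by norm_num))
  · exact sum_sq_pow_fourteen_le_of_through k _ fun p hp => tensorJump_eq_zero k q hp
  · exact sum_sq_pow_fourteen_le _

variable [∀ k, IsProbabilityMeasure (ν k)]

lemma integrable_tensorForm_pow (hI : ∀ k, Integrable (fun x : ℝ => x ^ 56) (ν k))
    (hM : ∀ k, ∫ x, x ^ 56 ∂(ν k) ≤ M) (hM0 : 0 ≤ M)
    {A : Matrix (PairIdx d) (PairIdx d) ℝ} (hA : ‖A‖ ≤ 1) {j : ℕ} (hj : j ≤ 14) :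
    Integrable (fun v => tensorForm ν A v ^ j) (Measure.pi ν) := by
  refine integrable_pow_of_even (n := 14) (continuous_tensorForm A).aestronglyMeasurable
    (by decide) hj ?_
  refine ((integrable_finsetSum Finset.univ fun p _ =>
    (centeredTensor_moment hI hM hM0 p).1).const_mul (((d : ℝ) ^ 2) ^ 13)).mono'
    ((continuous_tensorForm A).pow 14).aestronglyMeasurable (.of_forall fun v => ?_)
  rw [Real.norm_eq_abs, abs_of_nonneg ((show Even 14 by decide).pow_nonneg _)]
  exact tensorForm_pow_le hA v

lemma integral_jumpSq_tensorForm_pow_le (hd : 1 ≤ d)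
    (hI : ∀ k, Integrable (fun x : ℝ => x ^ 56) (ν k))
    (hM : ∀ k, ∫ x, x ^ 56 ∂(ν k) ≤ M) (hM0 : 0 ≤ M)
    {A : Matrix (PairIdx d) (PairIdx d) ℝ} (hA : ‖A‖ ≤ 1) :
    ∫ q, jumpSq (tensorForm ν A) q ^ 7 ∂(doubled ν)
      ≤ 2 ^ 6 * 12 ^ 7 * (2 ^ 15 + 1) * entryBound M * (d : ℝ) ^ 22 := by
  have hd0 : 0 < (d : ℝ) := by exact_mod_cast hd
  have hB := (entryBound_pos hM0).le
  have hJ (k : Fin d) : Integrable (fun q => ∑ p ∈ pairsThrough k, tensorJump k q p ^ 28)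
      (doubled ν) := integrable_finsetSum _ fun p _ => (tensorJump_moment hI hM k p).1
  have hY0 : Integrable (fun v => ∑ p, centeredTensor (Measure.pi ν) id v p ^ 28)
      (Measure.pi ν) := integrable_finsetSum _ fun p _ => (centeredTensor_moment hI hM hM0 p).1
  have hY : Integrable (fun q => ∑ p, centeredTensor (Measure.pi ν) id (resample ∅ q) p ^ 28)
      (doubled ν) := (measurePreserving_resample ν ∅).integrable_comp_of_integrable hY0
  have hJi (k : Fin d) : ∫ q, ∑ p ∈ pairsThrough k, tensorJump k q p ^ 28 ∂(doubled ν)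
      ≤ 2 * d * entryBound M := by
    rw [integral_finsetSum _ fun p _ => (tensorJump_moment hI hM k p).1]
    refine (Finset.sum_le_card_nsmul _ _ _ fun p _ => (tensorJump_moment hI hM k p).2).trans ?_
    rw [nsmul_eq_mul]
    refine mul_le_mul_of_nonneg_right ?_ hB
    exact_mod_cast card_pairsThrough_le k
  have hYi : ∫ q, ∑ p, centeredTensor (Measure.pi ν) id (resample ∅ q) p ^ 28 ∂(doubled ν)
      ≤ d ^ 2 * entryBound M := by
    rw [integral_comp_of_measurePreserving (measurePreserving_resample ν ∅)
      hY0.aestronglyMeasurable,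
      integral_finsetSum _ fun p _ => (centeredTensor_moment hI hM hM0 p).1]
    refine (Finset.sum_le_card_nsmul _ _ _ fun p _ =>
      (centeredTensor_moment hI hM hM0 p).2).trans ?_
    rw [nsmul_eq_mul]
    refine mul_le_mul_of_nonneg_right ?_ hB
    exact_mod_cast card_pairIdx_le d
  have hT (k : Fin d) : Integrable (fun q => 2 * (d : ℝ) ^ 7 *
        ((2 * (d : ℝ)) ^ 13 * ∑ p ∈ pairsThrough k, tensorJump k q p ^ 28)
      + ((d : ℝ) ^ 7)⁻¹ * (((d : ℝ) ^ 2) ^ 13 *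
        ∑ p, centeredTensor (Measure.pi ν) id (resample ∅ q) p ^ 28)) (doubled ν) :=
    (((hJ k).const_mul _).const_mul _).add ((hY.const_mul _).const_mul _)
  refine (integral_mono_of_nonneg (.of_forall fun q => pow_nonneg (jumpSq_nonneg _ _) 7)
    ((integrable_finsetSum Finset.univ fun k _ => hT k).const_mul _)
    (.of_forall fun q => jumpSq_tensorForm_pow_le hd hA q)).trans ?_
  rw [integral_const_mul, integral_finsetSum _ fun k _ => hT k]
  have hk (k : Fin d) : ∫ q, 2 * (d : ℝ) ^ 7 *
        ((2 * (d : ℝ)) ^ 13 * ∑ p ∈ pairsThrough k, tensorJump k q p ^ 28)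
      + ((d : ℝ) ^ 7)⁻¹ * (((d : ℝ) ^ 2) ^ 13 *
        ∑ p, centeredTensor (Measure.pi ν) id (resample ∅ q) p ^ 28) ∂(doubled ν)
      ≤ (2 ^ 15 + 1) * entryBound M * (d : ℝ) ^ 21 := by
    rw [integral_add (((hJ k).const_mul _).const_mul _) ((hY.const_mul _).const_mul _),
      integral_const_mul, integral_const_mul, integral_const_mul, integral_const_mul]
    refine (add_le_add
      (mul_le_mul_of_nonneg_left (mul_le_mul_of_nonneg_left (hJi k) (by positivity))
        (by positivity))
      (mul_le_mul_of_nonneg_left (mul_le_mul_of_nonneg_left hYi (by positivity))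
        (by positivity))).trans (le_of_eq ?_)
    field_simp
  refine (mul_le_mul_of_nonneg_left (Finset.sum_le_sum fun k _ => hk k) (by norm_num)).trans
    (le_of_eq ?_)
  rw [Finset.sum_const, Finset.card_univ, Fintype.card_fin, nsmul_eq_mul]
  ring

lemma exists_pow_seven_eq {X : ℝ} (hX : 0 < X) : ∃ K : ℝ, 0 < K ∧ K ^ 7 = X := by
  refine ⟨X ^ ((1 : ℝ) / 7), Real.rpow_pos_of_pos hX _, ?_⟩
  rw [← Real.rpow_natCast, ← Real.rpow_mul hX.le]
  norm_num

lemma exists_tensorForm_moment_le (M : ℝ) (hM0 : 0 ≤ M) : ∃ C : ℝ, 0 < C ∧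
    ∀ {d : ℕ}, 1 ≤ d → ∀ {ν : Fin d → Measure ℝ} [∀ k, IsProbabilityMeasure (ν k)]
      {A : Matrix (PairIdx d) (PairIdx d) ℝ},
      (∀ k, Integrable (fun x : ℝ => x ^ 56) (ν k)) → (∀ k, ∫ x, x ^ 56 ∂(ν k) ≤ M) →
      ‖A‖ ≤ 1 →
      Integrable (fun v => (tensorForm ν A v - ∫ w, tensorForm ν A w ∂(Measure.pi ν)) ^ 14)
          (Measure.pi ν) ∧
        ∫ v, (tensorForm ν A v - ∫ w, tensorForm ν A w ∂(Measure.pi ν)) ^ 14 ∂(Measure.pi ν)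
          ≤ C * (d : ℝ) ^ 22 := by
  obtain ⟨C₀, hC₀, h⟩ := exists_integral_pow_fourteen_le
  have hB := entryBound_pos hM0
  refine ⟨C₀ * (2 ^ 6 * 12 ^ 7 * (2 ^ 15 + 1) * entryBound M), by positivity, ?_⟩
  intro d hd ν _ A hI hM hA
  have hd0 : 0 < (d : ℝ) := by exact_mod_cast hd
  set T := ∫ w, tensorForm ν A w ∂(Measure.pi ν) with hT
  have hQ : Integrable (fun v => tensorForm ν A v) (Measure.pi ν) := by
    simpa using integrable_tensorForm_pow hI hM hM0 hA (j := 1) (by norm_num)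
  have hc : Continuous fun v => tensorForm ν A v - T :=
    (continuous_tensorForm A).sub continuous_const
  have hev : Even 14 := by decide
  have hi : Integrable (fun v => (tensorForm ν A v - T) ^ 14) (Measure.pi ν) := by
    refine (((integrable_tensorForm_pow hI hM hM0 hA (j := 14) le_rfl).add
      (integrable_const (T ^ 14))).const_mul (2 ^ 13)).mono' (hc.pow 14).aestronglyMeasurable
      (.of_forall fun v => ?_)
    rw [Real.norm_eq_abs, abs_of_nonneg (hev.pow_nonneg _), sub_eq_add_neg]
    have := hev.add_pow_le (a := tensorForm ν A v) (b := -T)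
    rwa [hev.neg_pow] at this
  have h0 : ∫ v, (tensorForm ν A v - T) ∂(Measure.pi ν) = 0 := by
    rw [integral_sub hQ (integrable_const _)]
    simp [hT]
  obtain ⟨K, hK, hK7⟩ := exists_pow_seven_eq
    (X := 2 ^ 6 * 12 ^ 7 * (2 ^ 15 + 1) * entryBound M * (d : ℝ) ^ 22) (by positivity)
  refine ⟨hi, ?_⟩
  refine (h hK hc.aestronglyMeasurable hi h0 ?_).trans (le_of_eq ?_)
  · rw [jumpSq_sub_const, hK7]
    exact integral_jumpSq_tensorForm_pow_le hd hI hM hM0 hA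
  · rw [hK7]; ring

end QuadraticFormMoments

section Covariance

variable {d : ℕ}

/-- The exponent of the coordinate `j` in the monomial indexed by `p`. -/
def pairExp (p : PairIdx d) (j : Fin d) : ℕ :=
  (if p.1.1 = j then 1 else 0) + (if p.1.2 = j then 1 else 0)

lemma pairExp_le (p : PairIdx d) (j : Fin d) : pairExp p j ≤ 2 := by
  unfold pairExp; split_ifs <;> norm_num

/-- The coefficient of the monomial indexed by `p` in the reduced tensor square. -/
noncomputable def pairCoeff (p : PairIdx d) : ℝ := if p.1.1 < p.1.2 then √2 else 1

lemma reducedTensor_eq_prod (v : Fin d → ℝ) (p : PairIdx d) :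
    reducedTensor v p = pairCoeff p * ∏ j, v j ^ pairExp p j := by
  have h : ∏ j, v j ^ pairExp p j = v p.1.1 * v p.1.2 := by
    simp only [pairExp, pow_add, Finset.prod_mul_distrib, pow_ite, pow_one, pow_zero,
      Finset.prod_ite_eq, Finset.mem_univ, if_true]
  rw [h]
  unfold reducedTensor pairCoeff
  split_ifs with hlt
  · ring
  · have : p.1.1 = p.1.2 := le_antisymm p.2 (not_lt.1 hlt)
    rw [← this, sq_abs]; ring

variable {ν ν' : Fin d → Measure ℝ} {Ω : Type*} [MeasurableSpace Ω] {μ : Measure Ω}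
  {x : Ω → Fin d → ℝ}

lemma centeredTensor_map (hx : AEMeasurable x μ) (hlaw : μ.map x = Measure.pi ν) (ω : Ω) :
    centeredTensor μ x ω = centeredTensor (Measure.pi ν) id (x ω) := by
  funext p
  simp only [centeredTensor, id]
  rw [← hlaw, integral_map hx (continuous_reducedTensor p).aestronglyMeasurable]

lemma tensorCov_map (hx : AEMeasurable x μ) (hlaw : μ.map x = Measure.pi ν) :
    tensorCov μ x = tensorCov (Measure.pi ν) id := by
  ext p q
  simp only [tensorCov, Matrix.of_apply, centeredTensor_map hx hlaw]
  have hc := continuous_centeredTensor (ν := ν)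
  have hpq : Continuous fun v : Fin d → ℝ => centeredTensor (Measure.pi ν) id v p
      * centeredTensor (Measure.pi ν) id v q :=
    ((continuous_apply p).comp hc).mul ((continuous_apply q).comp hc)
  have h := integral_map (μ := μ) hx (f := fun v : Fin d → ℝ => centeredTensor (Measure.pi ν) id v p
      * centeredTensor (Measure.pi ν) id v q) hpq.aestronglyMeasurable
  rw [← h]
  congr 1

variable [∀ k, IsProbabilityMeasure (ν k)] [∀ k, IsProbabilityMeasure (ν' k)]

lemma integral_reducedTensor (p : PairIdx d) :
    ∫ v, reducedTensor v p ∂(Measure.pi ν)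
      = pairCoeff p * ∏ j, ∫ x, x ^ pairExp p j ∂(ν j) := by
  simp only [reducedTensor_eq_prod]
  rw [integral_const_mul, integral_fintype_prod_eq_prod (fun j (x : ℝ) => x ^ pairExp p j)]

lemma integral_reducedTensor_mul (p q : PairIdx d) :
    ∫ v, reducedTensor v p * reducedTensor v q ∂(Measure.pi ν)
      = pairCoeff p * pairCoeff q * ∏ j, ∫ x, x ^ (pairExp p j + pairExp q j) ∂(ν j) := by
  have h (v : Fin d → ℝ) : reducedTensor v p * reducedTensor v q
      = pairCoeff p * pairCoeff q * ∏ j, v j ^ (pairExp p j + pairExp q j) := by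
    simp only [reducedTensor_eq_prod, pow_add, Finset.prod_mul_distrib]
    ring
  simp only [h]
  rw [integral_const_mul,
    integral_fintype_prod_eq_prod (fun j (x : ℝ) => x ^ (pairExp p j + pairExp q j))]

lemma memLp_reducedTensor (hI : ∀ k, Integrable (fun x : ℝ => x ^ 56) (ν k)) (p : PairIdx d) :
    MemLp (fun v => reducedTensor v p) 2 (Measure.pi ν) :=
  (memLp_two_iff_integrable_sq (continuous_reducedTensor p).aestronglyMeasurable).2
    (integrable_reducedTensor hI (by norm_num) p)

lemma tensorCov_pi (hI : ∀ k, Integrable (fun x : ℝ => x ^ 56) (ν k)) (p q : PairIdx d) :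
    tensorCov (Measure.pi ν) id p q
      = ∫ v, reducedTensor v p * reducedTensor v q ∂(Measure.pi ν)
        - (∫ v, reducedTensor v p ∂(Measure.pi ν)) * ∫ v, reducedTensor v q ∂(Measure.pi ν) :=
  covariance_eq_sub (memLp_reducedTensor hI p) (memLp_reducedTensor hI q)

/-- The covariance of the tensor square of a vector with independent coordinates depends only on
the first four moments of the coordinates. -/
lemma tensorCov_pi_congr (hI : ∀ k, Integrable (fun x : ℝ => x ^ 56) (ν k))
    (hI' : ∀ k, Integrable (fun x : ℝ => x ^ 56) (ν' k))
    (h : ∀ k, ∀ t ∈ Finset.Icc 1 4, ∫ x, x ^ t ∂(ν k) = ∫ x, x ^ t ∂(ν' k)) :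
    tensorCov (Measure.pi ν) id = tensorCov (Measure.pi ν') id := by
  have h' (k : Fin d) {t : ℕ} (ht : t ≤ 4) : ∫ x, x ^ t ∂(ν k) = ∫ x, x ^ t ∂(ν' k) := by
    rcases Nat.eq_zero_or_pos t with rfl | h0
    · simp
    · exact h k t (Finset.mem_Icc.2 ⟨h0, ht⟩)
  have e1 (p : PairIdx d) (j : Fin d) :
      ∫ x, x ^ pairExp p j ∂(ν j) = ∫ x, x ^ pairExp p j ∂(ν' j) :=
    h' j ((pairExp_le p j).trans (by norm_num))
  have e2 (p q : PairIdx d) (j : Fin d) : ∫ x, x ^ (pairExp p j + pairExp q j) ∂(ν j)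
      = ∫ x, x ^ (pairExp p j + pairExp q j) ∂(ν' j) :=
    h' j (add_le_add (pairExp_le p j) (pairExp_le q j))
  ext p q
  rw [tensorCov_pi hI, tensorCov_pi hI']
  simp only [integral_reducedTensor_mul, integral_reducedTensor, e1, e2]

lemma trace_mul_tensorCov (hI : ∀ k, Integrable (fun x : ℝ => x ^ 56) (ν k))
    (A : Matrix (PairIdx d) (PairIdx d) ℝ) :
    (A * tensorCov (Measure.pi ν) id).trace = ∫ v, tensorForm ν A v ∂(Measure.pi ν) := by
  have hL (p : PairIdx d) : MemLp (fun v => centeredTensor (Measure.pi ν) id v p) 2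
      (Measure.pi ν) := (memLp_reducedTensor hI p).sub (memLp_const _)
  have hi (p q : PairIdx d) : Integrable (fun v => A p q *
      (centeredTensor (Measure.pi ν) id v q * centeredTensor (Measure.pi ν) id v p))
      (Measure.pi ν) := ((hL q).integrable_mul (hL p)).const_mul _
  have e (v : Fin d → ℝ) : tensorForm ν A v = ∑ p, ∑ q, A p q *
      (centeredTensor (Measure.pi ν) id v q * centeredTensor (Measure.pi ν) id v p) := by
    simp only [tensorForm, dotProduct, Matrix.mulVec, Finset.mul_sum]
    refine Finset.sum_congr rfl fun p _ => Finset.sum_congr rfl fun q _ => by ring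
  simp only [e]
  rw [integral_finsetSum _ fun p _ => integrable_finsetSum _ fun q _ => hi p q]
  simp only [Matrix.trace, Matrix.diag, Matrix.mul_apply]
  refine Finset.sum_congr rfl fun p _ => ?_
  rw [integral_finsetSum _ fun q _ => hi p q]
  refine Finset.sum_congr rfl fun q _ => ?_
  rw [integral_const_mul]
  rfl

lemma quadDev_pow_map (hI : ∀ k, Integrable (fun x : ℝ => x ^ 56) (ν k))
    (hx : AEMeasurable x μ) (hlaw : μ.map x = Measure.pi ν)
    (A : Matrix (PairIdx d) (PairIdx d) ℝ) (ω : Ω) :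
    quadDev A (tensorCov μ x) (centeredTensor μ x ω) ^ 14
      = (tensorForm ν A (x ω) - ∫ w, tensorForm ν A w ∂(Measure.pi ν)) ^ 14 := by
  rw [quadDev, (show Even 14 by decide).pow_abs, tensorCov_map hx hlaw,
    centeredTensor_map hx hlaw, trace_mul_tensorCov hI]
  rfl

end Covariance

section Scaling

variable {d : ℕ} {S : Matrix (Fin d) (Fin d) ℝ}

lemma sqrt_eq_diagonal (hS : S.PosSemidef) (hD : S.IsDiag) :
    CFC.sqrt S = Matrix.diagonal fun k => √(S k k) := by
  refine CFC.sqrt_unique ?_ ?_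
  · rw [Matrix.diagonal_mul_diagonal]
    simp only [Real.mul_self_sqrt (hS.diag_nonneg)]
    exact hD.diagonal_diag
  · rw [Matrix.nonneg_iff_posSemidef]
    exact Matrix.PosSemidef.diagonal fun k => Real.sqrt_nonneg _

lemma scaledVec_apply {Ω : Type*} (hS : S.PosSemidef) (hD : S.IsDiag) (z : Ω → Fin d → ℝ)
    (ω : Ω) (k : Fin d) : scaledVec S z ω k = √(S k k) * z ω k := by
  rw [scaledVec, sqrt_eq_diagonal hS hD, Matrix.mulVec_diagonal]

lemma diag_le_of_norm_le {c : ℝ} (hD : S.IsDiag) (hc : ‖S‖ ≤ c) (k : Fin d) : S k k ≤ c := by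
  rw [← hD.diagonal_diag, Matrix.l2_opNorm_diagonal] at hc
  exact (le_abs_self _).trans ((norm_le_pi_norm S.diag k).trans hc)

end Scaling

section ScaledVec

variable {d : ℕ} {Ω : Type*} [MeasurableSpace Ω] {μ : Measure Ω}
  {S : Matrix (Fin d) (Fin d) ℝ} {z : Ω → Fin d → ℝ}

/-- The laws of the coordinates of `scaledVec S z`, for diagonal `S`. -/
noncomputable def coordLaw (μ : Measure Ω) (S : Matrix (Fin d) (Fin d) ℝ) (z : Ω → Fin d → ℝ)
    (k : Fin d) : Measure ℝ :=
  μ.map fun ω => √(S k k) * z ω k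

lemma aemeasurable_scaledVec (hS : S.PosSemidef) (hD : S.IsDiag)
    (hz : ∀ k, AEMeasurable (fun ω => z ω k) μ) : AEMeasurable (scaledVec S z) μ := by
  rw [aemeasurable_pi_iff]
  intro k
  simp only [scaledVec_apply hS hD]
  exact (hz k).const_mul _

lemma isProbabilityMeasure_coordLaw [IsProbabilityMeasure μ]
    (hz : ∀ k, AEMeasurable (fun ω => z ω k) μ) (k : Fin d) :
    IsProbabilityMeasure (coordLaw μ S z k) :=
  Measure.isProbabilityMeasure_map ((hz k).const_mul _)

lemma map_scaledVec [IsProbabilityMeasure μ] (hS : S.PosSemidef) (hD : S.IsDiag)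
    (hz : ∀ k, AEMeasurable (fun ω => z ω k) μ) (hind : iIndepFun (fun k ω => z ω k) μ) :
    μ.map (scaledVec S z) = Measure.pi (coordLaw μ S z) := by
  have h := hind.comp (fun k t => √(S k k) * t) fun k => measurable_const_mul _
  have h2 := (iIndepFun_iff_map_fun_eq_pi_map fun k => (hz k).const_mul (√(S k k))).1 h
  have e : scaledVec S z = fun ω k => √(S k k) * z ω k := by
    funext ω k
    exact scaledVec_apply hS hD z ω k
  rw [e]
  exact h2

lemma integral_pow_coordLaw (hz : ∀ k, AEMeasurable (fun ω => z ω k) μ) (k : Fin d) (t : ℕ) :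
    ∫ x, x ^ t ∂(coordLaw μ S z k) = √(S k k) ^ t * ∫ ω, z ω k ^ t ∂μ := by
  rw [coordLaw, integral_map ((hz k).const_mul _) (by fun_prop), ← integral_const_mul]
  simp only [mul_pow]

lemma integrable_pow_coordLaw (hz : ∀ k, AEMeasurable (fun ω => z ω k) μ) (k : Fin d)
    {t : ℕ} (hi : Integrable (fun ω => z ω k ^ t) μ) :
    Integrable (fun x => x ^ t) (coordLaw μ S z k) := by
  rw [coordLaw, integrable_map_measure (by fun_prop) ((hz k).const_mul _)]
  simpa only [Function.comp_def, mul_pow] using hi.const_mul (√(S k k) ^ t)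

lemma integrable_pow_of_memLp {f : Ω → ℝ} {t : ℕ} (ht : Even t) (ht0 : t ≠ 0) (hf : MemLp f t μ) :
    Integrable (fun ω => f ω ^ t) μ := by
  have := hf.integrable_norm_pow ht0
  simpa only [Real.norm_eq_abs, ht.pow_abs] using this

lemma exists_quadDev_moment_le (M C₃ : ℝ) : ∃ C : ℝ, 0 < C ∧
    ∀ (d : ℕ), 1 ≤ d →
    ∀ (Ω : Type*) [MeasurableSpace Ω] (μ : Measure Ω) [IsProbabilityMeasure μ]
      (S : Matrix (Fin d) (Fin d) ℝ) (z : Ω → Fin d → ℝ)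
      (A : Matrix (PairIdx d) (PairIdx d) ℝ),
    S.PosSemidef → S.IsDiag → ‖S‖ ≤ C₃ →
    iIndepFun (fun k ω => z ω k) μ →
    (∀ k, MemLp (fun ω => z ω k) 56 μ ∧ ∫ ω, |z ω k| ^ 56 ∂μ ≤ M) →
    ‖A‖ ≤ 1 →
    Integrable (fun ω => quadDev A (tensorCov μ (scaledVec S z))
        (centeredTensor μ (scaledVec S z) ω) ^ 14) μ ∧
      ∫ ω, quadDev A (tensorCov μ (scaledVec S z))
        (centeredTensor μ (scaledVec S z) ω) ^ 14 ∂μ ≤ C * (d : ℝ) ^ 22 := by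
  obtain ⟨C, hC, h⟩ := exists_tensorForm_moment_le (|C₃| ^ 28 * |M|) (by positivity)
  refine ⟨C, hC, ?_⟩
  intro d hd Ω _ μ _ S z A hS hD hSn hind hz hA
  have h56 : Even 56 := by decide
  have hzm (k : Fin d) : AEMeasurable (fun ω => z ω k) μ := (hz k).1.aestronglyMeasurable.aemeasurable
  have hzi (k : Fin d) : Integrable (fun ω => z ω k ^ 56) μ :=
    integrable_pow_of_memLp h56 (by norm_num) (by exact_mod_cast (hz k).1)
  have := isProbabilityMeasure_coordLaw (S := S) hzm
  have hI (k : Fin d) : Integrable (fun x => x ^ 56) (coordLaw μ S z k) :=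
    integrable_pow_coordLaw hzm k (hzi k)
  have hM (k : Fin d) : ∫ x, x ^ 56 ∂(coordLaw μ S z k) ≤ |C₃| ^ 28 * |M| := by
    rw [integral_pow_coordLaw hzm k]
    have e : √(S k k) ^ 56 = (S k k) ^ 28 := by
      rw [show 56 = 2 * 28 by norm_num, pow_mul, Real.sq_sqrt hS.diag_nonneg]
    have h1 : S k k ≤ |C₃| := (diag_le_of_norm_le hD hSn k).trans (le_abs_self _)
    have h2 : ∫ ω, z ω k ^ 56 ∂μ ≤ |M| := by
      have := (hz k).2
      simp only [h56.pow_abs] at this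
      exact this.trans (le_abs_self _)
    rw [e]
    exact mul_le_mul (pow_le_pow_left₀ hS.diag_nonneg h1 28) h2
      (integral_nonneg fun ω => h56.pow_nonneg _) (by positivity)
  have hx := aemeasurable_scaledVec hS hD hzm
  have hlaw := map_scaledVec hS hD hzm hind
  obtain ⟨h1, h2⟩ := h hd hI hM hA
  simp only [quadDev_pow_map hI hx hlaw A]
  rw [← hlaw] at h1 h2
  rw [integrable_map_measure h1.aestronglyMeasurable hx] at h1
  refine ⟨?_, ?_⟩
  · rw [hlaw] at h1
    exact h1
  · rw [integral_map hx, hlaw] at h2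
    · exact h2
    · exact (((continuous_tensorForm A).sub continuous_const).pow 14).aestronglyMeasurable

end ScaledVec

section UniformBound

lemma integral_abs_pow_le {Ω : Type*} [MeasurableSpace Ω] {μ : Measure Ω} [IsProbabilityMeasure μ]
    {f : Ω → ℝ} {c : ℝ} (hf : MemLp f 90 μ)
    (hc : (∫ ω, |f ω| ^ 90 ∂μ) ^ (1 / 90 : ℝ) ≤ c) :
    MemLp f 56 μ ∧ ∫ ω, |f ω| ^ 56 ∂μ ≤ 1 + c ^ 90 := by
  have hi : Integrable (fun ω => |f ω| ^ 90) μ := by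
    have := hf.integrable_norm_pow (p := 90) (by norm_num)
    simpa only [Real.norm_eq_abs] using this
  have h0 : 0 ≤ ∫ ω, |f ω| ^ 90 ∂μ := integral_nonneg fun ω => by positivity
  have hle : ∫ ω, |f ω| ^ 90 ∂μ ≤ c ^ 90 := by
    refine le_of_eq_of_le ?_ (pow_le_pow_left₀ (Real.rpow_nonneg h0 _) hc 90)
    generalize ∫ ω, |f ω| ^ 90 ∂μ = a at h0
    rw [← Real.rpow_mul_natCast h0]
    norm_num
  refine ⟨hf.mono_exponent (by norm_num), ?_⟩
  refine (integral_mono_of_nonneg (.of_forall fun ω => pow_nonneg (abs_nonneg (f ω)) 56)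
    ((integrable_const (1 : ℝ)).add hi) (.of_forall fun ω => ?_)).trans ?_
  · simp only [Pi.add_apply]
    have := abs_nonneg (f ω)
    generalize |f ω| = t at *
    rcases le_total t 1 with h | h
    · have h1 := pow_le_one₀ (n := 56) this h
      have h2 := pow_nonneg this 90
      linarith
    · have := pow_le_pow_right₀ h (show 56 ≤ 90 by norm_num)
      linarith
  · simp only [Pi.add_apply]
    rw [integral_add (integrable_const _) hi]
    simpa using hle

lemma tensorCov_scaledVec_congr {d : ℕ} {Ω : Type*} [MeasurableSpace Ω] {μ : Measure Ω}
    [IsProbabilityMeasure μ] {S : Matrix (Fin d) (Fin d) ℝ} {z z' : Ω → Fin d → ℝ}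
    (hS : S.PosSemidef) (hD : S.IsDiag)
    (hind : iIndepFun (fun k ω => z ω k) μ) (hind' : iIndepFun (fun k ω => z' ω k) μ)
    (hz : ∀ k, MemLp (fun ω => z ω k) 56 μ) (hz' : ∀ k, MemLp (fun ω => z' ω k) 56 μ)
    (h : ∀ k, ∀ t ∈ Finset.Icc 1 4, ∫ ω, z ω k ^ t ∂μ = ∫ ω, z' ω k ^ t ∂μ) :
    tensorCov μ (scaledVec S z) = tensorCov μ (scaledVec S z') := by
  have hzm (k : Fin d) : AEMeasurable (fun ω => z ω k) μ := (hz k).aestronglyMeasurable.aemeasurable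
  have hzm' (k : Fin d) : AEMeasurable (fun ω => z' ω k) μ :=
    (hz' k).aestronglyMeasurable.aemeasurable
  have := isProbabilityMeasure_coordLaw (S := S) hzm
  have := isProbabilityMeasure_coordLaw (S := S) hzm'
  have h56 : Even 56 := by decide
  rw [tensorCov_map (aemeasurable_scaledVec hS hD hzm) (map_scaledVec hS hD hzm hind),
    tensorCov_map (aemeasurable_scaledVec hS hD hzm') (map_scaledVec hS hD hzm' hind')]
  refine tensorCov_pi_congr
    (fun k => integrable_pow_coordLaw hzm k
      (integrable_pow_of_memLp h56 (by norm_num) (by exact_mod_cast hz k)))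
    (fun k => integrable_pow_coordLaw hzm' k
      (integrable_pow_of_memLp h56 (by norm_num) (by exact_mod_cast hz' k))) fun k t ht => ?_
  rw [integral_pow_coordLaw hzm, integral_pow_coordLaw hzm', h k t ht]

lemma measureReal_le_of_moment {Ω : Type*} [MeasurableSpace Ω] {μ : Measure Ω}
    [IsProbabilityMeasure μ] {n : ℕ} (hn : 1 ≤ n) {f : Ω → ℝ}
    (hi : Integrable (fun ω => f ω ^ 14) μ) {C B : ℝ} (hC : 1 ≤ C)
    (hB : ∫ ω, f ω ^ 14 ∂μ ≤ B) :
    μ.real {ω | ¬ 1 / (n : ℝ) * f ω ≤ C * (n : ℝ) ^ (-(1 / 60) : ℝ)} ≤ B / (n : ℝ) ^ 13 := by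
  have hn1 : (1 : ℝ) ≤ n := by exact_mod_cast hn
  have hn0 : (0 : ℝ) < n := by linarith
  have hmarkov := mul_meas_ge_le_integral_of_nonneg (μ := μ) (f := fun ω => f ω ^ 14)
    (.of_forall fun ω => (show Even 14 by decide).pow_nonneg _) hi ((n : ℝ) ^ 13)
  have hsub : {ω | ¬ 1 / (n : ℝ) * f ω ≤ C * (n : ℝ) ^ (-(1 / 60) : ℝ)}
      ⊆ {ω | (n : ℝ) ^ 13 ≤ f ω ^ 14} := by
    intro ω hω
    simp only [Set.mem_ofPred_eq, not_le] at hω ⊢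
    have hr : 0 < (n : ℝ) ^ (-(1 / 60) : ℝ) := Real.rpow_pos_of_pos hn0 _
    have h1 : (n : ℝ) ^ (-(1 / 60) : ℝ) < 1 / (n : ℝ) * f ω :=
      lt_of_le_of_lt (le_mul_of_one_le_left hr.le hC) hω
    have h2 : n * (n : ℝ) ^ (-(1 / 60) : ℝ) ≤ f ω := by
      have := mul_le_mul_of_nonneg_left h1.le hn0.le
      rwa [← mul_assoc, mul_one_div_cancel hn0.ne', one_mul] at this
    refine le_trans ?_ (pow_le_pow_left₀ (by positivity) h2 14)
    have h3 : (n : ℝ)⁻¹ ≤ ((n : ℝ) ^ (-(1 / 60) : ℝ)) ^ 14 := by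
      rw [← Real.rpow_natCast, ← Real.rpow_mul hn0.le, ← Real.rpow_neg_one]
      exact Real.rpow_le_rpow_of_exponent_le hn1 (by norm_num)
    rw [mul_pow]
    calc (n : ℝ) ^ 13 = (n : ℝ) ^ 14 * (n : ℝ)⁻¹ := by field_simp
      _ ≤ _ := mul_le_mul_of_nonneg_left h3 (by positivity)
  rw [le_div_iff₀ (by positivity), mul_comm]
  exact (mul_le_mul_of_nonneg_left (measureReal_mono hsub) (by positivity)).trans
    (hmarkov.trans hB)

lemma one_sub_sum_le_measureReal_forall {Ω ι : Type*} [MeasurableSpace Ω] {μ : Measure Ω}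
    [IsProbabilityMeasure μ] [Fintype ι] (p : ι → Ω → Prop) :
    1 - ∑ i, μ.real {ω | ¬ p i ω} ≤ μ.real {ω | ∀ i, p i ω} := by
  have h1 : (Set.univ : Set Ω) ⊆ {ω | ∀ i, p i ω} ∪ ⋃ i, {ω | ¬ p i ω} := by
    intro ω _
    by_cases h : ∀ i, p i ω
    · exact Or.inl h
    · push Not at h
      exact Or.inr (Set.mem_iUnion.2 h)
  have h2 := (measureReal_mono (μ := μ) h1).trans (measureReal_union_le _ _)
  have h3 := measureReal_iUnion_fintype_le (μ := μ) fun i => {ω | ¬ p i ω}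
  rw [probReal_univ] at h2
  linarith

end UniformBound

theorem mainTheorem6 :
    (∀ M C₃ : ℝ, ∃ C : ℝ,
      ∀ (d : ℕ), 1 ≤ d →
      ∀ (Ω : Type*) [MeasurableSpace Ω] (μ : Measure Ω) [IsProbabilityMeasure μ]
        (S : Matrix (Fin d) (Fin d) ℝ) (z : Ω → Fin d → ℝ)
        (A : Matrix (PairIdx d) (PairIdx d) ℝ),
      S.PosSemidef → S.IsDiag → ‖S‖ ≤ C₃ →
      iIndepFun (fun k ω => z ω k) μ →
      (∀ k, MemLp (fun ω => z ω k) 56 μ ∧ ∫ ω, |z ω k| ^ 56 ∂μ ≤ M) →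
      (∀ k, ∫ ω, z ω k ∂μ = 0 ∧ ∫ ω, z ω k ^ 3 ∂μ = 0 ∧ ∫ ω, z ω k ^ 5 ∂μ = 0) →
      ‖A‖ ≤ 1 →
      Integrable (fun ω => quadDev A (tensorCov μ (scaledVec S z))
          (centeredTensor μ (scaledVec S z) ω) ^ 14) μ ∧
        ∫ ω, quadDev A (tensorCov μ (scaledVec S z))
          (centeredTensor μ (scaledVec S z) ω) ^ 14 ∂μ ≤ C * (d : ℝ) ^ (25.5 : ℝ)) ∧
    (∀ C₁ C₂ C₃ : ℝ, ∃ C : ℝ,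
      ∀ (n d : ℕ), 1 ≤ d → (d : ℝ) ^ 2 ≤ C₁ * n →
      ∀ (Ω : Type*) [MeasurableSpace Ω] (μ : Measure Ω) [IsProbabilityMeasure μ]
        (S : Matrix (Fin d) (Fin d) ℝ) (z : Fin n → Ω → Fin d → ℝ)
        (A : Matrix (PairIdx d) (PairIdx d) ℝ),
      S.PosSemidef → S.IsDiag → ‖S‖ ≤ C₃ →
      iIndepFun z μ →
      (∀ i, iIndepFun (fun k ω => z i ω k) μ) →
      (∀ i k, MemLp (fun ω => z i ω k) 90 μ ∧
        (∫ ω, |z i ω k| ^ 90 ∂μ) ^ (1 / 90 : ℝ) ≤ C₂) →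
      (∀ i k, ∀ t ∈ Finset.Icc 1 8,
        ∫ ω, z i ω k ^ t ∂μ = ∫ g, g ^ t ∂(gaussianReal 0 1)) →
      ‖A‖ ≤ 1 →
      -- the matrix `tensorCov μ (scaledVec S (z i₀))` does not depend on `i₀`
      ∀ i₀ : Fin n,
        1 - C * (d : ℝ) ^ (-(1 / 5) : ℝ) ≤
          μ.real {ω | ∀ i : Fin n,
            1 / (n : ℝ) * quadDev A (tensorCov μ (scaledVec S (z i₀)))
              (centeredTensor μ (scaledVec S (z i)) ω) ≤ C * (n : ℝ) ^ (-(1 / 60) : ℝ)}) := by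
  refine ⟨fun M C₃ => ?_, fun C₁ C₂ C₃ => ?_⟩
  · obtain ⟨C, hC, h⟩ := exists_quadDev_moment_le M C₃
    refine ⟨C, ?_⟩
    intro d hd Ω _ μ _ S z A hS hD hSn hind hz _ hA
    obtain ⟨h1, h2⟩ := h d hd Ω μ S z A hS hD hSn hind hz hA
    refine ⟨h1, h2.trans (mul_le_mul_of_nonneg_left ?_ hC.le)⟩
    rw [← Real.rpow_natCast]
    exact Real.rpow_le_rpow_of_exponent_le (by exact_mod_cast hd) (by norm_num)
  · obtain ⟨K, hK, h⟩ := exists_quadDev_moment_le (1 + C₂ ^ 90) C₃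
    refine ⟨1 + K * |C₁| ^ 12, ?_⟩
    intro n d hd hdn Ω _ μ _ S z A hS hD hSn _ hind hz hmom hA i₀
    have hn : 1 ≤ n := (Nat.zero_le _).trans_lt i₀.2
    have hn0 : (0 : ℝ) < n := by exact_mod_cast hn
    have hd1 : (1 : ℝ) ≤ d := by exact_mod_cast hd
    have hd0 : (0 : ℝ) < d := by linarith
    have hz' (i : Fin n) (k : Fin d) := integral_abs_pow_le (hz i k).1 (hz i k).2
    have hcov (i : Fin n) : tensorCov μ (scaledVec S (z i₀)) = tensorCov μ (scaledVec S (z i)) := by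
      refine tensorCov_scaledVec_congr hS hD (hind i₀) (hind i) (fun k => (hz' i₀ k).1)
        (fun k => (hz' i k).1) fun k t ht => ?_
      have ht8 : t ∈ Finset.Icc 1 8 := Finset.Icc_subset_Icc_right (by norm_num) ht
      rw [hmom i₀ k t ht8, hmom i k t ht8]
    have hbad (i : Fin n) : μ.real {ω | ¬ 1 / (n : ℝ) *
        quadDev A (tensorCov μ (scaledVec S (z i₀))) (centeredTensor μ (scaledVec S (z i)) ω)
          ≤ (1 + K * |C₁| ^ 12) * (n : ℝ) ^ (-(1 / 60) : ℝ)} ≤ K * (d : ℝ) ^ 22 / (n : ℝ) ^ 13 := by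
      obtain ⟨h1, h2⟩ := h d hd Ω μ S (z i) A hS hD hSn (hind i) (hz' i) hA
      rw [hcov i]
      exact measureReal_le_of_moment hn h1 (le_add_of_nonneg_right (by positivity)) h2
    refine le_trans ?_ (one_sub_sum_le_measureReal_forall _)
    refine sub_le_sub_left ?_ 1
    refine (Finset.sum_le_sum fun i _ => hbad i).trans ?_
    rw [Finset.sum_const, Finset.card_univ, Fintype.card_fin, nsmul_eq_mul]
    have hdn' : (d : ℝ) ^ 24 ≤ |C₁| ^ 12 * (n : ℝ) ^ 12 := by
      have h1 : (d : ℝ) ^ 2 ≤ |C₁| * n :=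
        hdn.trans (mul_le_mul_of_nonneg_right (le_abs_self _) hn0.le)
      have h2 := pow_le_pow_left₀ (by positivity) h1 12
      rwa [← pow_mul, mul_pow] at h2
    have h5 : ((d : ℝ) ^ 2)⁻¹ ≤ (d : ℝ) ^ (-(1 / 5) : ℝ) := by
      rw [← Real.rpow_natCast, ← Real.rpow_neg hd0.le]
      exact Real.rpow_le_rpow_of_exponent_le hd1 (by norm_num)
    calc (n : ℝ) * (K * (d : ℝ) ^ 22 / (n : ℝ) ^ 13)
        = K * ((d : ℝ) ^ 24 / (n : ℝ) ^ 12) * ((d : ℝ) ^ 2)⁻¹ := by field_simp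
      _ ≤ K * |C₁| ^ 12 * ((d : ℝ) ^ 2)⁻¹ := by
          refine mul_le_mul_of_nonneg_right (mul_le_mul_of_nonneg_left ?_ hK.le) (by positivity)
          rwa [div_le_iff₀ (by positivity)]
      _ ≤ (1 + K * |C₁| ^ 12) * (d : ℝ) ^ (-(1 / 5) : ℝ) :=
          mul_le_mul (by linarith) h5 (by positivity) (by positivity)
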